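/- Let $E/\mathbb{Q}$ be an elliptic curve and let $d\ge 3$ be an integer. For a monic cubic polynomial $f\in\mathbb{Q}[x]$ define $P_f(x,t)\in\mathbb{Q}[x,t]$ by $$P_f(x,t)=\begin{cases} t^2x^d-f(x), & d \text{ even},\\ x^{d-3}f(x)-t^2, & d\ge 5 \text{ odd},\\ f(x)-(x+t)^2, & d=3.\end{cases}$$ Then there exist a prime $p$ and a monic cubic polynomial $f(x)=x^3+Bx^2+Cx+D$ with $B,C,D\in\mathbb{Z}[1/p]$ such that $y^2=f(x)$ is a Weierstrass model of $E$ (that is, a Weierstrass equation of a curve isomorphic to $E$ over $\mathbb{Q}$) and such that $\mathbb{Q}(t)[x]/(P_f(x,t))$ is a field extension of $\mathbb{Q}(t)$ of degree $d$ whose Galois closure has Galois group over $\mathbb{Q}(t)$ isomorphic to the symmetric group $S_d$. -/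

import Mathlib

open scoped Polynomial

noncomputable section

/-- `y² = f(x)` is a Weierstrass model of `E` over `ℚ`: `f` is a monic cubic, and the curve
`y² = x³ + f₂ x² + f₁ x + f₀` is obtained from `E` by an admissible change of variables
over `ℚ` (that is, it is isomorphic to `E` over `ℚ`). -/
def IsWeierstrassModel (E : WeierstrassCurve ℚ) (f : ℚ[X]) : Prop :=
  f.Monic ∧ f.natDegree = 3 ∧
    ∃ v : WeierstrassCurve.VariableChange ℚ,
      v • E = { a₁ := 0, a₂ := f.coeff 2, a₃ := 0, a₄ := f.coeff 1, a₆ := f.coeff 0 }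

/-- All coefficients of `f` lie in `ℤ[1/p]`. -/
def IsIntegralAwayFrom (p : ℕ) (f : ℚ[X]) : Prop :=
  ∀ i : ℕ, ∃ (k : ℕ) (n : ℤ), f.coeff i * (p : ℚ) ^ k = n

/-- The polynomial `P_f(x, t)` attached to `f` and to `d ≥ 3`, as a polynomial in `x` over `ℚ(t)`:
`f(x) - (x + t)²` for `d = 3`, `t² x ^ d - f(x)` for even `d`, and
`x ^ (d - 3) f(x) - t²` for odd `d ≥ 5`. -/
def pointPolynomial (d : ℕ) (f : ℚ[X]) : (RatFunc ℚ)[X] :=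
  if d = 3 then
    f.map (algebraMap ℚ (RatFunc ℚ)) - (Polynomial.X + Polynomial.C RatFunc.X) ^ 2
  else if Even d then
    Polynomial.C (RatFunc.X ^ 2) * Polynomial.X ^ d - f.map (algebraMap ℚ (RatFunc ℚ))
  else
    Polynomial.X ^ (d - 3) * f.map (algebraMap ℚ (RatFunc ℚ)) - Polynomial.C (RatFunc.X ^ 2)

/-- `K = F[x]/(P)` is a field extension of `F` of degree `d`, and the automorphism group over `F`
of its Galois closure (the normal closure of `K/F` in an algebraic closure of `K`; it is Galois
over `F` as part of the assertion) is the symmetric group on `d` letters. -/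
def GeneratesSymmetricExtension {F : Type*} [Field F] (P : F[X]) (d : ℕ) : Prop :=
  ∃ _ : Fact (Irreducible P),
    Module.finrank F (AdjoinRoot P) = d ∧
    IsGalois F (IntermediateField.normalClosure F (AdjoinRoot P)
      (AlgebraicClosure (AdjoinRoot P))) ∧
    Nonempty
      ((IntermediateField.normalClosure F (AdjoinRoot P) (AlgebraicClosure (AdjoinRoot P)) ≃ₐ[F]
        IntermediateField.normalClosure F (AdjoinRoot P) (AlgebraicClosure (AdjoinRoot P))) ≃*
        Equiv.Perm (Fin d))

end

/-!
The model is `f(x) = (x - r)³ + A (x - r) + B` with integers `A`, `B` divisible by an auxiliary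
prime `q`, and an integer `r` chosen modulo `q` and modulo a second prime `p`. All coefficients
being integers, the integrality condition holds for any prime.

As an equation in `t` over `ℚ[x]`, the polynomial `P` attached to `f` is a primitive quadratic without
roots in `ℚ(x)`, so `P` is irreducible over `ℚ(t)` by Gauss's lemma (`irreducible_pointPolynomial`). By
Jordan's theorem its Galois group is symmetric once it is primitive and contains a transposition
(`generatesSymmetricExtension_of_swap`). Both properties come from reduction. Let `V` be
a valuation ring of the algebraic numbers, with residue field `k`. Putting a suitable function
of a new variable `s` in the place of `t` embeds `ℚ(t)` in `K = Frac V[s]`, and the Galois group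
over `K` maps to that over `ℚ(t)`. If, after a substitution for `x`, the equation is given by
a monic polynomial over `V[s]`, then every automorphism of a normal extension of `k(s)` generated
by the reductions of its roots is induced by an automorphism over `K`
(`exists_residue_extension`).

*Transposition.* Take `V` above `q`. Modulo `q` the cubic is `(x - r)³`, and the equation has the
form `g(x) = (e x + T)²` with `e = 0` for `d ≥ 4` and `e = 1` for `d = 3`. It has a simple critical
point `x₀` at a value `T₀` of `T`, and no other critical point with that value. For
`T = T₀ + π² s`, with `π` in the maximal ideal of `V`, the reduction is constant in `s`, with
a double root at `x₀` and simple roots elsewhere, all of them in `k`. The two roots reducing to `x₀`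
differ by `π` times a quantity whose square reduces to a constant times `s`; an automorphism
over `k(s)` changing the sign of the square root of `s` therefore induces a transposition
(`exists_swap_of_double_root`, `exists_gal_swap_of_critical_point`).

*Primitivity.* For `d = 3` it is clear. For `d ≥ 4`, take `V` above a prime `p` that divides `f(0)`
but not `f'(0)`. After scaling by powers of the cube root of `p`, the equation reduces to
`z ^ d = b s² z ^ j`, with `j = 1` for even `d` and `j = 2` for odd `d`. Since `d - j` is odd,
`z ^ (d - j) = b s²` is irreducible over `k(s)`, so automorphisms preserving a set of `j` roots
permute the other ones transitively (`exists_gal_transitive_of_reduction`), which makes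
the transitive group primitive (`isPreprimitive_of_transitive_off_small_set`).

The prime `p` and the shift `r` are found by making `r³ + A r - B` divisible by a prime not dividing
the discriminant (`exists_shift`).
-/

/-! ### Primitivity, and symmetric Galois groups -/

section GroupTheory

open MulAction Pointwise

/-- A transitive action is primitive as soon as some small set `S` (a point, or a pair of points in
a set of odd cardinality) has the property that its stabilizer moves any point outside `S` to any
other one: a block meeting both `S` and its complement has translates through the points of `S`
that cover everything. -/
theorem isPreprimitive_of_transitive_off_small_set {G X : Type*} [Group G] [MulAction G X]
    [Finite X] [IsPretransitive G X] (S : Set X)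
    (hcard : S.ncard = 1 ∨ (S.ncard = 2 ∧ Odd (Nat.card X)))
    (hS : ∀ x ∉ S, ∀ y ∉ S, ∃ g : G, g • S = S ∧ g • x = y) : IsPreprimitive G X := by
  obtain ⟨r, hr⟩ : S.Nonempty := by
    rw [← Set.ncard_pos (Set.toFinite S)]; rcases hcard with h | h <;> omega
  refine IsPreprimitive.of_isTrivialBlock_base r fun {B} hrB hB => ?_
  by_cases hsub : B.Subsingleton
  · exact Or.inl hsub
  right
  have hnon : B.Nontrivial := Set.not_subsingleton_iff.mp hsub
  have hB2 : 1 < B.ncard := (Set.one_lt_ncard_iff_nontrivial_and_finite).mpr ⟨hnon, B.toFinite⟩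
  have hdvd : B.ncard ∣ Nat.card X := hB.ncard_dvd_card ⟨r, hrB⟩
  by_cases hBS : B ⊆ S
  · exfalso
    have h1 := Set.ncard_le_ncard hBS S.toFinite
    rcases hcard with h | ⟨h, hodd⟩
    · omega
    · have : B.ncard = 2 := by omega
      rw [this] at hdvd
      exact (Nat.not_even_iff_odd.mpr hodd) (even_iff_two_dvd.mpr hdvd)
  obtain ⟨x, hxB, hxS⟩ := Set.not_subset.mp hBS
  -- Every point outside `S` lies in a translate of `B` that contains a point of `S`.
  have hcov : ∀ y ∉ S, ∃ s ∈ S, ∃ g : G, g • r = s ∧ y ∈ g • B := by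
    intro y hy
    obtain ⟨g, hgS, hgx⟩ := hS x hxS y hy
    exact ⟨g • r, hgS ▸ Set.smul_mem_smul_set hr, g, rfl, hgx ▸ Set.smul_mem_smul_set hxB⟩
  have hsame : ∀ g g' : G, g • r ∈ g' • B → g • B = g' • B := by
    intro g g' h
    exact hB.smul_eq_smul_of_nonempty ⟨_, Set.smul_mem_smul_set hrB, h⟩
  -- So `B` and its translate through the other point of `S`, if there is one, cover everything.
  have htwo : ∃ g₀ : G, (Set.univ : Set X) ⊆ B ∪ g₀ • B ∧ (S.ncard = 1 → g₀ = 1) := by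
    rcases hcard with h | ⟨h, -⟩
    · obtain ⟨a, ha⟩ := Set.ncard_eq_one.mp h
      refine ⟨1, fun y _ => ?_, fun _ => rfl⟩
      by_cases hy : y ∈ S
      · rw [ha] at hy hr
        left; rw [Set.mem_singleton_iff.mp hy, ← Set.mem_singleton_iff.mp hr]; exact hrB
      · obtain ⟨s, hs, g, hg, hyg⟩ := hcov y hy
        rw [ha] at hs hr
        have : g • r ∈ (1 : G) • B := by
          rw [hg, one_smul, Set.mem_singleton_iff.mp hs, ← Set.mem_singleton_iff.mp hr]; exact hrB
        right; rw [← hsame g 1 this]; exact hyg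
    · obtain ⟨a, b, hab, hS2⟩ := Set.ncard_eq_two.mp h
      obtain ⟨r', hr'⟩ : ∃ r', S ⊆ {r, r'} := by
        rw [hS2] at hr
        rcases hr with rfl | hr
        · exact ⟨b, hS2.le⟩
        · rw [Set.mem_singleton_iff] at hr; subst hr
          exact ⟨a, by rw [hS2, Set.pair_comm]⟩
      obtain ⟨g₀, hg₀⟩ := exists_smul_eq G r r'
      have hmem : ∀ s ∈ S, s ∈ B ∨ s ∈ g₀ • B := by
        intro s hs
        rcases hr' hs with rfl | hs
        · exact Or.inl hrB
        · right; rw [Set.mem_singleton_iff.mp hs, ← hg₀]; exact Set.smul_mem_smul_set hrB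
      refine ⟨g₀, fun y _ => ?_, fun h' => by omega⟩
      by_cases hy : y ∈ S
      · exact hmem y hy
      · obtain ⟨s, hs, g, hg, hyg⟩ := hcov y hy
        rcases hmem s hs with h' | h'
        · left
          have := hsame g 1 (by rw [one_smul, hg]; exact h')
          rw [one_smul] at this
          rwa [← this]
        · right
          rw [← hsame g g₀ (hg ▸ h')]; exact hyg
  obtain ⟨g₀, hg₀, hg₁⟩ := htwo
  rcases hcard with h | ⟨-, hodd⟩
  · rw [hg₁ h, one_smul, Set.union_self] at hg₀
    exact Set.univ_subset_iff.mp hg₀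
  · have h1 : Nat.card X ≤ 2 * B.ncard := by
      rw [← Set.ncard_univ]
      refine (Set.ncard_le_ncard hg₀ (Set.toFinite _)).trans ((Set.ncard_union_le _ _).trans ?_)
      rw [Set.ncard_smul_set]; omega
    obtain ⟨k, hk⟩ := hdvd
    have hk2 : k ≤ 2 := by
      by_contra hk3
      have : B.ncard * 3 ≤ B.ncard * k := Nat.mul_le_mul_left _ (by omega)
      omega
    have hk1 : k = 1 := by
      rw [hk] at hodd
      have := (Nat.odd_mul.mp hodd).2
      interval_cases k
      · exact absurd this (by decide)
      · rfl
      · exact absurd this (by decide)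
    refine Set.eq_of_subset_of_ncard_le (Set.subset_univ _) ?_ (Set.toFinite _)
    rw [Set.ncard_univ, hk, hk1, mul_one]

end GroupTheory

section Galois

open Polynomial

/-- An irreducible polynomial over a field of characteristic zero generates an `S_d`-extension once
its Galois group induces all permutations of its roots. -/
theorem generatesSymmetricExtension_of_surjective {F : Type*} [Field F] [CharZero F] {P : F[X]}
    {d : ℕ} (hirr : Irreducible P) (hdeg : P.natDegree = d)
    (hsurj : ∀ g : Equiv.Perm (P.rootSet P.SplittingField), ∃ σ : P.Gal, ∀ x, σ • x = g x) :
    GeneratesSymmetricExtension P d := by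
  classical
  have hf : Fact (Irreducible P) := ⟨hirr⟩
  refine ⟨hf, ?_, ?_⟩
  · rw [(AdjoinRoot.powerBasis hirr.ne_zero).finrank, AdjoinRoot.powerBasis_dim, hdeg]
  set K := AdjoinRoot P
  set L := AlgebraicClosure K
  have : FiniteDimensional F K := (AdjoinRoot.powerBasis hirr.ne_zero).finite
  have : Algebra.IsAlgebraic F L := Algebra.IsAlgebraic.trans F K L
  have : IsAlgClosure F L := ⟨inferInstance, inferInstance⟩
  have : Normal F L := IsAlgClosure.normal F L
  set N := IntermediateField.normalClosure F K L
  have : Normal F N := normalClosure.normal F K L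
  have : FiniteDimensional F N := normalClosure.is_finiteDimensional F K L
  have hgal : IsGalois F N := ⟨⟩
  refine ⟨hgal, ?_⟩
  have hN : N = IntermediateField.adjoin F (P.rootSet L) := by
    apply le_antisymm
    · refine normalClosure_le_iff.mpr fun f => ?_
      rintro _ ⟨x, rfl⟩
      have hx : x ∈ IntermediateField.adjoin F {AdjoinRoot.root P} := by
        rw [IntermediateField.adjoin_root_eq_top]; trivial
      have : f x ∈ (IntermediateField.adjoin F {AdjoinRoot.root P}).map f := ⟨x, hx, rfl⟩
      rw [IntermediateField.adjoin_map, Set.image_singleton] at this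
      refine IntermediateField.adjoin.mono F _ _ ?_ this
      rintro _ rfl
      rw [mem_rootSet]
      refine ⟨hirr.ne_zero, ?_⟩
      rw [aeval_algHom_apply, AdjoinRoot.aeval_eq, AdjoinRoot.mk_self, map_zero]
    · rw [IntermediateField.adjoin_le_iff]
      intro x hx
      have hx' := (mem_rootSet.mp hx).2
      exact (AlgHom.fieldRange_le_normalClosure
        (AdjoinRoot.liftAlgHom P (Algebra.ofId F L) x hx'))
          ⟨AdjoinRoot.root P, AdjoinRoot.lift_root hx'⟩
  have : IsSplittingField F N P := by
    rw [hN]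
    exact IntermediateField.adjoin_rootSet_isSplittingField (IsAlgClosed.splits _)
  let e : N ≃ₐ[F] P.SplittingField := IsSplittingField.algEquiv N P
  have hcard : Fintype.card (P.rootSet P.SplittingField) = Fintype.card (Fin d) := by
    rw [Fintype.card_fin, ← hdeg]
    exact card_rootSet_eq_natDegree hirr.separable (SplittingField.splits P)
  let e' : P.rootSet P.SplittingField ≃ Fin d := Fintype.equivOfCardEq hcard
  have hbij : Function.Bijective
      (MulAction.toPermHom P.Gal (P.rootSet P.SplittingField)) := by
    constructor
    · intro a b hab
      refine Gal.ext _ fun x hx => ?_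
      exact congrArg Subtype.val (Equiv.congr_fun hab ⟨x, hx⟩)
    · intro g
      obtain ⟨σ, hσ⟩ := hsurj g
      exact ⟨σ, Equiv.ext hσ⟩
  let e3 : (P.SplittingField ≃ₐ[F] P.SplittingField) ≃* P.Gal := MulEquiv.refl _
  exact ⟨(AlgEquiv.autCongr e).trans (e3.trans ((MulEquiv.ofBijective _ hbij).trans
    e'.permCongrHom))⟩

end Galois

/-! ### Reduction in Galois extensions -/

section Residue

open Polynomial

universe u

/-- Reduction in a finite Galois extension `L` of the fraction field `K` of an integrally closed
domain `A`: given `φ : A → κ` identifying `κ` with the residue field at a prime, it extends to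
the integral closure of `A` in `L`, with values in a normal extension `ℓ` of `κ`, so that all
automorphisms of `ℓ` over `κ` are induced by automorphisms of `L` over `K`. -/
theorem exists_residue_extension {A K κ : Type*} {L : Type u} [CommRing A] [IsDomain A]
    [IsIntegrallyClosed A] [Field K] [Algebra A K] [IsFractionRing A K] [Field L] [Algebra K L]
    [Algebra A L] [IsScalarTower A K L] [FiniteDimensional K L] [IsGalois K L] [Field κ]
    (φ : A →+* κ) (hφ : ∀ z : κ, ∃ a b, φ b ≠ 0 ∧ z = φ a / φ b) :
    ∃ (ℓ : Type u) (_ : Field ℓ) (_ : Algebra κ ℓ) (_ : Normal κ ℓ)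
      (ρ : integralClosure A L →+* ℓ),
      (∀ a, ρ (algebraMap A _ a) = algebraMap κ ℓ (φ a)) ∧
      ∀ τ : ℓ ≃ₐ[κ] ℓ, ∃ σ : L ≃ₐ[K] L, ∀ x y : integralClosure A L,
        (y : L) = σ x → ρ y = τ (ρ x) := by
  let B := integralClosure A L
  have : IsFractionRing B L := integralClosure.isFractionRing_of_finite_extension K L
  let P : Ideal A := RingHom.ker φ
  have hP : P.IsPrime := RingHom.ker_isPrime φ
  have : Module.IsTorsionFree A L := by
    rw [Module.isTorsionFree_iff_faithfulSMul, faithfulSMul_iff_algebraMap_injective,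
      IsScalarTower.algebraMap_eq A K L]
    exact (algebraMap K L).injective.comp (IsFractionRing.injective A K)
  obtain ⟨Q, hQ, hQP⟩ : ∃ Q : Ideal B, Q.IsPrime ∧ Q.LiesOver P := by
    obtain ⟨Q, hQ⟩ := Ideal.nonempty_primesOver (S := B) (P := P)
    exact ⟨Q, hQ.1, hQ.2⟩
  let := IsIntegralClosure.MulSemiringAction A K L B
  have hinv : Algebra.IsInvariant A B Gal(L/K) := Algebra.isInvariant_of_isGalois A K L B
  have : SMulCommClass Gal(L/K) A B := ⟨fun g a b => (map_smul (galRestrict A K L B g) a b)⟩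
  let : Algebra (A ⧸ P) κ := (RingHom.kerLift φ).toAlgebra
  have hmk : ∀ a, algebraMap (A ⧸ P) κ (Ideal.Quotient.mk P a) = φ a := fun a => rfl
  have : IsFractionRing (A ⧸ P) κ := by
    have : FaithfulSMul (A ⧸ P) κ :=
      (faithfulSMul_iff_algebraMap_injective _ _).mpr (RingHom.kerLift_injective φ)
    refine IsFractionRing.of_field (A ⧸ P) κ fun z => ?_
    obtain ⟨a, b, -, hz⟩ := hφ z
    exact ⟨Ideal.Quotient.mk P a, Ideal.Quotient.mk P b, by rw [hmk, hmk, hz]⟩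
  let ℓ := FractionRing (B ⧸ Q)
  have hinj : Function.Injective (algebraMap (A ⧸ P) ℓ) := by
    have h : Function.Injective (algebraMap (A ⧸ P) (B ⧸ Q)) :=
      FaithfulSMul.algebraMap_injective _ _
    rw [IsScalarTower.algebraMap_eq (A ⧸ P) (B ⧸ Q) ℓ, RingHom.coe_comp]
    exact (IsFractionRing.injective (B ⧸ Q) ℓ).comp h
  let : Algebra κ ℓ := (IsFractionRing.lift hinj).toAlgebra
  have : IsScalarTower (A ⧸ P) κ ℓ := IsScalarTower.of_algebraMap_eq fun x =>
    (IsFractionRing.lift_algebraMap hinj x).symm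
  have hn : Normal κ ℓ := Ideal.IsFractionRing.normal Gal(L/K) P Q κ ℓ
  refine ⟨ℓ, inferInstance, inferInstance, hn,
    (algebraMap (B ⧸ Q) ℓ).comp (Ideal.Quotient.mk Q), fun a => ?_, fun τ => ?_⟩
  · rw [← hmk, ← IsScalarTower.algebraMap_apply, IsScalarTower.algebraMap_apply (A ⧸ P) (B ⧸ Q) ℓ]
    rfl
  · obtain ⟨g, hg⟩ := IsFractionRing.stabilizerHom_surjective Gal(L/K) P Q κ ℓ τ
    refine ⟨g.1, fun x y hxy => ?_⟩
    have : y = g.1 • x := Subtype.ext (hxy.trans (algebraMap_galRestrict_apply A g.1 x).symm)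
    rw [← hg, this]
    exact (IsFractionRing.stabilizerHom_apply_apply_mk Gal(L/K) P Q κ ℓ g x).symm

/-- A monic polynomial over an integrally closed subring of a field in which it splits is a product
of linear factors over that subring. -/
theorem exists_eq_prod_X_sub_C {B L : Type*} [CommRing B] [Field L] [Algebra B L]
    [IsIntegrallyClosedIn B L] {N : B[X]} (hN : N.Monic)
    (hs : (N.map (algebraMap B L)).Splits) :
    ∃ R : Multiset B, N = (R.map (fun r => X - C r)).prod ∧
      R.map (algebraMap B L) = (N.map (algebraMap B L)).roots := by
  have hinj : Function.Injective (algebraMap B L) :=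
    IsIntegralClosure.algebraMap_injective B B L
  have hmem : ∀ x ∈ (N.map (algebraMap B L)).roots, ∃ b : B, algebraMap B L b = x := by
    intro x hx
    refine (IsIntegralClosure.isIntegral_iff (R := B) (A := B)).mp ⟨N, hN, ?_⟩
    rw [← eval_map]
    exact (mem_roots'.mp hx).2
  obtain ⟨R, hR⟩ : ∃ R : Multiset B, R.map (algebraMap B L) = (N.map (algebraMap B L)).roots := by
    choose! g hg using hmem
    refine ⟨(N.map (algebraMap B L)).roots.map g, ?_⟩
    rw [Multiset.map_map]
    exact (Multiset.map_congr rfl fun x hx => hg x hx).trans (Multiset.map_id _)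
  refine ⟨R, ?_, hR⟩
  apply map_injective _ hinj
  rw [hs.eq_prod_roots_of_monic (hN.map _), ← hR, Polynomial.map_multiset_prod, Multiset.map_map,
    Multiset.map_map]
  congr 1
  refine Multiset.map_congr rfl fun x _ => ?_
  simp

end Residue

/-! ### Transitivity and transpositions from reduction -/

section LocalMonodromy

open Polynomial

universe u

variable {A K κ : Type*} {L : Type u} [CommRing A] [IsDomain A] [IsIntegrallyClosed A] [Field K]
  [Algebra A K] [IsFractionRing A K] [Field L] [Algebra K L] [Algebra A L] [IsScalarTower A K L]
  [FiniteDimensional K L] [IsGalois K L] [Field κ]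

/-- The roots of a monic polynomial with coefficients in `A`, together with their reductions. -/
theorem exists_reduced_roots (φ : A →+* κ) (hφ : ∀ z : κ, ∃ a b, φ b ≠ 0 ∧ z = φ a / φ b)
    {N : A[X]} (hN : N.Monic) (hs : (N.map (algebraMap A L)).Splits)
    (hsep : (N.map (algebraMap A K)).Separable) :
    ∃ (ℓ : Type u) (_ : Field ℓ) (_ : Algebra κ ℓ) (_ : Normal κ ℓ)
      (ρ : integralClosure A L →+* ℓ) (R : Multiset (integralClosure A L)),
      (∀ a, ρ (algebraMap A _ a) = algebraMap κ ℓ (φ a)) ∧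
      (∀ τ : ℓ ≃ₐ[κ] ℓ, ∃ σ : L ≃ₐ[K] L, ∀ x y : integralClosure A L,
        (y : L) = σ x → ρ y = τ (ρ x)) ∧
      R.Nodup ∧ N.map (algebraMap A (integralClosure A L)) = (R.map (fun r => X - C r)).prod ∧
      R.map ρ = ((N.map φ).map (algebraMap κ ℓ)).roots ∧
      ∀ x : L, aeval x N = 0 ↔ ∃ r ∈ R, (r : L) = x := by
  obtain ⟨ℓ, i1, i2, i3, ρ, h1, h2⟩ := exists_residue_extension (K := K) (L := L) φ hφ
  have hcomp : (algebraMap (integralClosure A L) L).comp (algebraMap A (integralClosure A L)) =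
      algebraMap A L := (IsScalarTower.algebraMap_eq _ _ _).symm
  obtain ⟨R, hR, hR'⟩ := exists_eq_prod_X_sub_C (L := L)
    (hN.map (algebraMap A (integralClosure A L))) (by rwa [Polynomial.map_map, hcomp])
  rw [Polynomial.map_map, hcomp] at hR'
  have hsepL : (N.map (algebraMap A L)).Separable := by
    rw [IsScalarTower.algebraMap_eq A K L, ← Polynomial.map_map]
    exact hsep.map
  refine ⟨ℓ, i1, i2, i3, ρ, R, h1, h2, ?_, hR, ?_, fun x => ?_⟩
  · refine Multiset.Nodup.of_map (algebraMap (integralClosure A L) L) ?_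
    rw [hR']
    exact nodup_roots hsepL
  · have hc : (algebraMap κ ℓ).comp φ = ρ.comp (algebraMap A (integralClosure A L)) :=
      RingHom.ext fun a => (h1 a).symm
    rw [Polynomial.map_map, hc, ← Polynomial.map_map, hR, Polynomial.map_multiset_prod,
      Multiset.map_map]
    have : (Multiset.map ((Polynomial.map ρ) ∘ fun r => X - C r) R) =
        (R.map ρ).map (fun r => X - C r) := by
      rw [Multiset.map_map]
      exact Multiset.map_congr rfl fun x _ => by simp
    rw [this, roots_multiset_prod_X_sub_C]
  · have hne : N.map (algebraMap A L) ≠ 0 := (hN.map _).ne_zero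
    rw [aeval_def, ← eval_map, ← IsRoot.def, ← mem_roots hne, ← hR', Multiset.mem_map]
    rfl

/-- If the reduction of `N` is `X ^ j` times an irreducible separable polynomial, then the
automorphisms preserving the set of roots with vanishing reduction are transitive on the others. -/
theorem exists_transitive_off_small_set (φ : A →+* κ)
    (hφ : ∀ z : κ, ∃ a b, φ b ≠ 0 ∧ z = φ a / φ b)
    {N : A[X]} (hN : N.Monic) (hs : (N.map (algebraMap A L)).Splits)
    (hsep : (N.map (algebraMap A K)).Separable) {j : ℕ} {q : κ[X]}
    (hq : N.map φ = X ^ j * q) (hirr : Irreducible q) (hqsep : q.Separable) (hq0 : q.eval 0 ≠ 0) :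
    ∃ S : Set L, S ⊆ {x | aeval x N = 0} ∧ S.ncard = j ∧
      ∀ x y, aeval x N = 0 → x ∉ S → aeval y N = 0 → y ∉ S →
        ∃ σ : L ≃ₐ[K] L, σ '' S = S ∧ σ x = y := by
  classical
  obtain ⟨ℓ, _, _, _, ρ, R, h1, h2, hnd, -, hRρ, hmem⟩ :=
    exists_reduced_roots (K := K) (L := L) φ hφ hN hs hsep
  have hq' : (N.map φ).map (algebraMap κ ℓ) = X ^ j * q.map (algebraMap κ ℓ) := by
    rw [hq]; simp
  have hqne : q.map (algebraMap κ ℓ) ≠ 0 := (Polynomial.map_ne_zero_iff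
    (algebraMap κ ℓ).injective).mpr hirr.ne_zero
  have hroots : R.map ρ = j • {0} + (q.map (algebraMap κ ℓ)).roots := by
    rw [hRρ, hq', roots_mul (mul_ne_zero (pow_ne_zero _ X_ne_zero) hqne), roots_pow, roots_X]
  have hq0' : (0 : ℓ) ∉ (q.map (algebraMap κ ℓ)).roots := by
    rw [mem_roots hqne, IsRoot.def, ← map_zero (algebraMap κ ℓ), eval_map_algebraMap,
      aeval_algebraMap_apply_eq_algebraMap_eval, map_zero, map_eq_zero]
    exact hq0
  have hqroot : ∀ r ∈ R, ρ r ≠ 0 → ρ r ∈ (q.map (algebraMap κ ℓ)).roots := by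
    intro r hr h0
    have : ρ r ∈ R.map ρ := Multiset.mem_map_of_mem _ hr
    rw [hroots, Multiset.mem_add] at this
    rcases this with h | h
    · exact absurd (Multiset.mem_singleton.mp (Multiset.mem_of_mem_nsmul h)) h0
    · exact h
  have hqinj : ∀ r ∈ R, ∀ r' ∈ R, ρ r ≠ 0 → ρ r = ρ r' → r = r' := by
    intro r hr r' hr' h0 heq
    by_contra hne
    have hc : (R.map ρ).count (ρ r) = 1 := by
      rw [hroots, Multiset.count_add, Multiset.count_nsmul, Multiset.count_singleton, if_neg h0,
        mul_zero, zero_add]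
      exact Multiset.count_eq_one_of_mem (nodup_roots hqsep.map) (hqroot r hr h0)
    obtain ⟨R₁, rfl⟩ := Multiset.exists_cons_of_mem hr
    obtain ⟨R₂, rfl⟩ := Multiset.exists_cons_of_mem
      ((Multiset.mem_cons.mp hr').resolve_left (Ne.symm hne))
    rw [Multiset.map_cons, Multiset.map_cons, ← heq, Multiset.count_cons_self,
      Multiset.count_cons_self] at hc
    omega
  have hmap : ∀ (σ : L ≃ₐ[K] L), ∀ r ∈ R, ∃ r' ∈ R, (r' : L) = σ r := by
    intro σ r hr
    rw [← hmem]
    have : σ (r : L) = (σ.toAlgHom.restrictScalars A) r := rfl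
    rw [this, aeval_algHom_apply, (hmem r).mpr ⟨r, hr, rfl⟩, map_zero]
  let S₀ : Multiset (integralClosure A L) := R.filter (fun r => ρ r = 0)
  let S : Set L := (fun r : integralClosure A L => (r : L)) '' {r | r ∈ R ∧ ρ r = 0}
  refine ⟨S, ?_, ?_, ?_⟩
  · rintro _ ⟨r, ⟨hr, -⟩, rfl⟩
    exact (hmem _).mpr ⟨r, hr, rfl⟩
  · rw [Set.ncard_image_of_injective _ Subtype.val_injective]
    have : {r | r ∈ R ∧ ρ r = 0} = ((⟨S₀, hnd.filter _⟩ : Finset _) : Set _) := by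
      ext r; simp [S₀]
    rw [this, Set.ncard_coe_finset, Finset.card_mk]
    have hc : (R.map ρ).count 0 = j := by
      rw [hroots, Multiset.count_add, Multiset.count_nsmul, Multiset.count_singleton_self,
        Multiset.count_eq_zero_of_notMem hq0', mul_one, add_zero]
    rw [← hc, Multiset.count_map]
    simp only [S₀, eq_comm]
  · intro x y hx hxS hy hyS
    obtain ⟨r, hr, rfl⟩ := (hmem x).mp hx
    obtain ⟨r', hr', rfl⟩ := (hmem y).mp hy
    have hr0 : ρ r ≠ 0 := fun h => hxS ⟨r, ⟨hr, h⟩, rfl⟩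
    have hr0' : ρ r' ≠ 0 := fun h => hyS ⟨r', ⟨hr', h⟩, rfl⟩
    have hconj : IsConjRoot κ (ρ r') (ρ r) := by
      have e1 := (mem_roots'.mp (hqroot r hr hr0)).2
      have e2 := (mem_roots'.mp (hqroot r' hr' hr0')).2
      rw [IsRoot.def, eval_map_algebraMap] at e1 e2
      rw [isConjRoot_def, ← minpoly.eq_of_irreducible hirr e1,
        ← minpoly.eq_of_irreducible hirr e2]
    obtain ⟨τ, hτ⟩ := isConjRoot_iff_exists_algEquiv.mp hconj
    obtain ⟨σ, hσ⟩ := h2 τ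
    have hsub : σ '' S ⊆ S := by
      rintro _ ⟨_, ⟨s, ⟨hs, hs0⟩, rfl⟩, rfl⟩
      obtain ⟨s', hs', e⟩ := hmap σ s hs
      exact ⟨s', ⟨hs', by rw [hσ s s' e, hs0, map_zero]⟩, e⟩
    have hfin : S.Finite := ((R.toFinset.finite_toSet).subset
      (fun r hr => by simpa using hr.1)).image _
    refine ⟨σ, Set.eq_of_subset_of_ncard_le hsub
      (Set.ncard_image_of_injective _ σ.injective).ge hfin, ?_⟩
    obtain ⟨s, hs, e⟩ := hmap σ r hr
    have : r' = s := hqinj r' hr' s hs hr0' (by rw [hσ r s e, hτ])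
    rw [this, e]

/-- In a normal extension of characteristic not two, a square root of a non-square is moved by some
automorphism. -/
theorem exists_algEquiv_sqrt_ne {κ ℓ : Type*} [Field κ] [Field ℓ] [Algebra κ ℓ] [Normal κ ℓ]
    (h2 : (2 : κ) ≠ 0) {θ : ℓ} {c : κ} (hθ : θ ^ 2 = algebraMap κ ℓ c) (hc : ∀ z : κ, z ^ 2 ≠ c) :
    ∃ τ : ℓ ≃ₐ[κ] ℓ, τ θ ≠ θ := by
  have hirr : Irreducible (X ^ 2 - C c) := X_pow_sub_C_irreducible_of_prime Nat.prime_two hc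
  have hθ0 : θ ≠ 0 := by
    rintro rfl
    refine hc 0 ?_
    apply (algebraMap κ ℓ).injective
    rw [← hθ]; simp
  have e1 : aeval θ (X ^ 2 - C c) = 0 := by simp [hθ]
  have e2 : aeval (-θ) (X ^ 2 - C c) = 0 := by simp [hθ]
  have hconj : IsConjRoot κ (-θ) θ := by
    rw [isConjRoot_def, ← minpoly.eq_of_irreducible hirr e1, ← minpoly.eq_of_irreducible hirr e2]
  obtain ⟨τ, hτ⟩ := isConjRoot_iff_exists_algEquiv.mp hconj
  refine ⟨τ, fun h => ?_⟩
  rw [hτ] at h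
  have h2' : (2 : ℓ) ≠ 0 := by
    rw [← map_ofNat (algebraMap κ ℓ) 2]
    exact (_root_.map_ne_zero _).mpr h2
  have : 2 * θ = 0 := by linear_combination -h
  exact (mul_ne_zero h2' hθ0) this

/-- A non-degenerate critical point produces a transposition. The reduction of `N` has a double
root at `x₀` and is otherwise split with simple roots; so an automorphism compatible with the
reduction fixes all roots of `N` except the two roots `α`, `β` reducing to `x₀`. If `N` and its
derivative are divisible by `π ^ 2` at `x₀`, then the square of `(α - β) / π` is, up to squares,
a non-square of the residue field, and some automorphism exchanges `α` and `β`. -/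
theorem exists_swap_of_double_root (φ : A →+* κ)
    (hφ : ∀ z : κ, ∃ a b, φ b ≠ 0 ∧ z = φ a / φ b)
    {N : A[X]} (hN : N.Monic) (hs : (N.map (algebraMap A L)).Splits)
    (hsep : (N.map (algebraMap A K)).Separable) {x₀ π u v : A} (hπ : π ≠ 0) (hπ0 : φ π = 0)
    (hu : N.eval x₀ = π ^ 2 * u) (hv : N.derivative.eval x₀ = π ^ 2 * v) {h : κ[X]}
    (hred : N.map φ = (X - C (φ x₀)) ^ 2 * h) (h0 : h.eval (φ x₀) ≠ 0) (hhsep : h.Separable)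
    (hhs : h.Splits) (h2 : (2 : κ) ≠ 0)
    (hc : ∀ z : κ, z ^ 2 ≠ -4 * h.eval (φ x₀) ^ 3 * φ u) :
    ∃ σ : L ≃ₐ[K] L, ∃ α β : L, aeval α N = 0 ∧ aeval β N = 0 ∧ α ≠ β ∧ σ α = β ∧ σ β = α ∧
      ∀ x, aeval x N = 0 → x ≠ α → x ≠ β → σ x = x := by
  classical
  obtain ⟨ℓ, _, _, _, ρ, R, h1, hlift, hnd, hprod, hRρ, hmem⟩ :=
    exists_reduced_roots (K := K) (L := L) φ hφ hN hs hsep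
  set ξ : ℓ := algebraMap κ ℓ (φ x₀) with hξ
  have hhne : h ≠ 0 := by rintro rfl; simp at h0
  have hhne' : h.map (algebraMap κ ℓ) ≠ 0 :=
    (Polynomial.map_ne_zero_iff (algebraMap κ ℓ).injective).mpr hhne
  have hroots : R.map ρ = 2 • {ξ} + (h.map (algebraMap κ ℓ)).roots := by
    rw [hRρ, hred, Polynomial.map_mul, Polynomial.map_pow, Polynomial.map_sub, map_X, map_C,
      roots_mul (mul_ne_zero (pow_ne_zero _ (X_sub_C_ne_zero _)) hhne'), roots_pow, roots_X_sub_C]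
  have hξh : ξ ∉ (h.map (algebraMap κ ℓ)).roots := by
    rw [mem_roots hhne', IsRoot.def, hξ, eval_map_algebraMap,
      aeval_algebraMap_apply_eq_algebraMap_eval, map_eq_zero]
    exact h0
  -- The two roots reducing to `x₀`, and the remaining ones.
  have hcard : (R.filter (fun r => ρ r = ξ)).card = 2 := by
    have hcount : (R.map ρ).count ξ = 2 := by
      rw [hroots, Multiset.count_add, Multiset.count_nsmul, Multiset.count_singleton_self,
        Multiset.count_eq_zero_of_notMem hξh]
    rw [← hcount, Multiset.count_map]
    simp only [eq_comm]
  obtain ⟨a, b, hab⟩ := Multiset.card_eq_two.mp hcard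
  set R' := R.filter (fun r => ¬ ρ r = ξ) with hR'
  have hsplit : R = {a, b} + R' := by rw [← hab, hR', Multiset.filter_add_not]
  have haR : a ∈ R ∧ ρ a = ξ := by
    rw [← Multiset.mem_filter (p := fun r => ρ r = ξ), hab]; simp
  have hbR : b ∈ R ∧ ρ b = ξ := by
    rw [← Multiset.mem_filter (p := fun r => ρ r = ξ), hab]; simp
  have hne : a ≠ b := by
    have := hnd.filter (fun r => ρ r = ξ)
    rw [hab] at this
    simpa using this
  have hR'map : R'.map ρ = (h.map (algebraMap κ ℓ)).roots := by
    have e : R.map ρ = 2 • {ξ} + R'.map ρ := by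
      rw [hsplit, Multiset.map_add, two_nsmul]
      simp [haR.2, hbR.2, Multiset.singleton_add]
    exact add_left_cancel (e.symm.trans hroots)
  have hR'inj : ∀ r ∈ R', ∀ r' ∈ R, ρ r' = ρ r → r' = r := by
    intro r hr r' hr' he
    have hr'' : r' ∈ R' := by
      rw [hR', Multiset.mem_filter, he]
      exact ⟨hr', (Multiset.mem_filter.mp hr).2⟩
    exact Multiset.inj_on_of_nodup_map (hR'map ▸ nodup_roots hhsep.map) r' hr'' r hr he
  have hR'κ : ∀ r ∈ R', ∃ c : κ, algebraMap κ ℓ c = ρ r := by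
    intro r hr
    have : ρ r ∈ R'.map ρ := Multiset.mem_map_of_mem _ hr
    rw [hR'map, hhs.roots_map, Multiset.mem_map] at this
    obtain ⟨c, -, hc⟩ := this
    exact ⟨c, hc⟩
  -- The cofactor `S` of `(X - a) (X - b)`, and the resulting relations at `x₀`.
  let B := integralClosure A L
  let i : A →+* B := algebraMap A B
  let S : B[X] := (R'.map (fun r => X - C r)).prod
  have hfac : N.map i = (X - C a) * (X - C b) * S := by
    rw [show N.map i = _ from hprod, hsplit, Multiset.map_add, Multiset.prod_add]
    simp [S, Multiset.insert_eq_cons]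
  set S0 : B := S.eval (i x₀) with hS0
  set S1 : B := S.derivative.eval (i x₀) with hS1
  have r1 : (i x₀ - a) * (i x₀ - b) * S0 = i π ^ 2 * i u := by
    have := congrArg (eval (i x₀)) hfac
    rw [eval_map, eval₂_at_apply, hu] at this
    simpa [← hS0] using this.symm
  have r2 : ((i x₀ - a) + (i x₀ - b)) * S0 + (i x₀ - a) * (i x₀ - b) * S1 = i π ^ 2 * i v := by
    have := congrArg (fun p => eval (i x₀) (derivative p)) hfac
    simp only [derivative_map] at this
    rw [eval_map, eval₂_at_apply, hv] at this
    simp only [derivative_mul, eval_add, eval_mul, derivative_sub, derivative_X, derivative_C,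
      sub_zero, eval_one, eval_sub, eval_X, eval_C, map_mul, map_pow, ← hS0, ← hS1] at this
    linear_combination -this
  have hρS0 : ρ S0 = algebraMap κ ℓ (h.eval (φ x₀)) := by
    have hhm : h.Monic := (((monic_X_sub_C (φ x₀)).pow 2).of_mul_monic_left (hred ▸ hN.map φ))
    have e : S.map ρ = h.map (algebraMap κ ℓ) := by
      rw [(hhs.map (algebraMap κ ℓ)).eq_prod_roots_of_monic (hhm.map _), ← hR'map,
        Polynomial.map_multiset_prod, Multiset.map_map, Multiset.map_map]
      congr 1
      exact Multiset.map_congr rfl fun x _ => by simp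
    rw [hS0, ← eval₂_at_apply, ← eval_map, e, h1, eval_map_algebraMap,
      aeval_algebraMap_apply_eq_algebraMap_eval]
  let W : B := i π ^ 2 * (i v * S0 - i u * S1) ^ 2 - 4 * S0 ^ 3 * i u
  have hW : (S0 ^ 2 * (a - b)) ^ 2 = i π ^ 2 * W := by
    have E : ((i x₀ - a) + (i x₀ - b)) * S0 ^ 2 = i π ^ 2 * (i v * S0 - i u * S1) := by
      linear_combination S0 * r2 - S1 * r1
    linear_combination (((i x₀ - a) + (i x₀ - b)) * S0 ^ 2 + i π ^ 2 * (i v * S0 - i u * S1)) * E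
      - 4 * S0 ^ 3 * r1
  have hρi : ∀ z, ρ (i z) = algebraMap κ ℓ (φ z) := h1
  have hπL : algebraMap A L π ≠ 0 := by
    rw [IsScalarTower.algebraMap_apply A K L, Ne, map_eq_zero]
    exact (map_ne_zero_iff _ (IsFractionRing.injective A K)).mpr hπ
  let θ : L := ((S0 : L) ^ 2 * ((a : L) - b)) / algebraMap A L π
  have hθ : θ ^ 2 = (W : L) := by
    have := congrArg (fun z : B => (z : L)) hW
    have hiπ : ((i π : B) : L) = algebraMap A L π := rfl
    simp only [MulMemClass.coe_mul, SubmonoidClass.coe_pow, AddSubgroupClass.coe_sub, hiπ] at this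
    rw [div_pow, div_eq_iff (pow_ne_zero _ hπL)]
    linear_combination this
  have hθint : IsIntegral A θ := by
    refine IsIntegral.of_pow two_pos ?_
    rw [hθ]
    exact W.2
  let Θ : B := ⟨θ, hθint⟩
  have hΘ : Θ ^ 2 = W := Subtype.ext hθ
  have hρΘ : ρ Θ ^ 2 = algebraMap κ ℓ (-4 * h.eval (φ x₀) ^ 3 * φ u) := by
    rw [← map_pow, hΘ]
    simp only [W, map_sub, map_mul, map_pow, hρi, hρS0, hπ0, map_zero, map_ofNat, map_neg]
    ring
  obtain ⟨τ, hτ⟩ := exists_algEquiv_sqrt_ne h2 hρΘ hc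
  obtain ⟨σ, hσ⟩ := hlift τ
  have hmap : ∀ r ∈ R, ∃ r' ∈ R, (r' : L) = σ r := by
    intro r hr
    rw [← hmem]
    have : σ (r : L) = (σ.toAlgHom.restrictScalars A) r := rfl
    rw [this, aeval_algHom_apply, (hmem r).mpr ⟨r, hr, rfl⟩, map_zero]
  have hfix : ∀ r ∈ R', σ r = r := by
    intro r hr
    obtain ⟨r', hr', e⟩ := hmap r (Multiset.mem_filter.mp hr).1
    obtain ⟨c, hc⟩ := hR'κ r hr
    have : r' = r := hR'inj r hr r' hr' (by rw [hσ r r' e, ← hc, τ.commutes])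
    rw [← e, this]
  have hpair : ∀ r ∈ R, ρ r = ξ → σ r = a ∨ σ r = b := by
    intro r hr hrξ
    obtain ⟨r', hr', e⟩ := hmap r hr
    rw [hsplit, Multiset.mem_add] at hr'
    rcases hr' with h' | h'
    · simp only [Multiset.insert_eq_cons, Multiset.mem_cons, Multiset.mem_singleton] at h'
      rcases h' with rfl | rfl
      · exact Or.inl e.symm
      · exact Or.inr e.symm
    · have : r' = r := Subtype.ext (σ.injective ((hfix r' h').trans e))
      rw [this] at h'
      exact absurd hrξ (Multiset.mem_filter.mp h').2
  have hσS0 : σ (S0 : L) = S0 := by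
    have e : (S0 : L) = (R'.map (fun r : B => algebraMap A L x₀ - (r : L))).prod := by
      rw [hS0, ← coe_evalRingHom, map_multiset_prod, Multiset.map_map,
        ← Subalgebra.val_apply, map_multiset_prod, Multiset.map_map]
      congr 1
      refine Multiset.map_congr rfl fun x _ => ?_
      simp
      rfl
    rw [e, map_multiset_prod, Multiset.map_map]
    congr 1
    refine Multiset.map_congr rfl fun x hx => ?_
    rw [Function.comp_apply, map_sub, hfix x hx, IsScalarTower.algebraMap_apply A K L, σ.commutes]
  have hneL : (a : L) ≠ b := fun h => hne (Subtype.ext h)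
  have hσa : σ a = b := by
    rcases hpair a haR.1 haR.2 with ha | ha
    · exfalso
      have hb : σ b = b := by
        rcases hpair b hbR.1 hbR.2 with hb | hb
        · exact absurd (σ.injective (ha.trans hb.symm)) hneL
        · exact hb
      refine hτ (hσ Θ Θ ?_).symm
      change θ = σ θ
      simp only [θ, map_div₀, map_mul, map_pow, map_sub, hσS0, ha, hb]
      rw [IsScalarTower.algebraMap_apply A K L, σ.commutes]
    · exact ha
  have hσb : σ b = a := by
    rcases hpair b hbR.1 hbR.2 with hb | hb
    · exact hb
    · exact absurd (σ.injective (hσa.trans hb.symm)) hneL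
  refine ⟨σ, a, b, (hmem a).mpr ⟨a, haR.1, rfl⟩, (hmem b).mpr ⟨b, hbR.1, rfl⟩, hneL, hσa, hσb, ?_⟩
  intro x hx hxa hxb
  obtain ⟨r, hr, rfl⟩ := (hmem x).mp hx
  refine hfix r ?_
  rw [hsplit, Multiset.mem_add] at hr
  refine hr.resolve_left fun h' => ?_
  simp only [Multiset.insert_eq_cons, Multiset.mem_cons, Multiset.mem_singleton] at h'
  rcases h' with rfl | rfl
  · exact hxa rfl
  · exact hxb rfl

end LocalMonodromy

/-! ### Change of the ground field -/

section Transport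

open Polynomial

/-- Extension of the ground field: along `ι : F → K`, automorphisms of an algebraic closure of `K`
induce elements of the Galois group of `P` over `F`. -/
theorem exists_gal_of_algEquiv {F K : Type*} [Field F] [Field K] (P : F[X]) (ι : F →+* K) :
    ∃ ε : P.SplittingField →+* AlgebraicClosure K,
      (∀ x, ε (algebraMap F _ x) = algebraMap K _ (ι x)) ∧
      ∀ σ : AlgebraicClosure K ≃ₐ[K] AlgebraicClosure K, ∃ g : P.Gal,
        ∀ x : P.rootSet P.SplittingField, ε (g • x : P.rootSet P.SplittingField) = σ (ε x) := by
  let : Algebra F K := ι.toAlgebra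
  let ε : P.SplittingField →ₐ[F] AlgebraicClosure K :=
    IsSplittingField.lift P.SplittingField P (IsAlgClosed.splits _)
  let : Algebra P.SplittingField (AlgebraicClosure K) := ε.toRingHom.toAlgebra
  have : IsScalarTower F P.SplittingField (AlgebraicClosure K) :=
    IsScalarTower.of_algebraMap_eq fun x => (ε.commutes x).symm
  refine ⟨ε.toRingHom, fun x => ?_, fun σ => ?_⟩
  · exact (ε.commutes x).trans (IsScalarTower.algebraMap_apply F K _ x)
  · refine ⟨(σ.restrictScalars F).restrictNormal P.SplittingField, fun x => ?_⟩
    exact AlgEquiv.restrictNormal_commutes (σ.restrictScalars F) P.SplittingField x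

/-- If an injective map `θ`, commuting with all automorphisms over `K`, takes the roots of `P`
to roots of a polynomial `N` over `K` of no larger degree, then `N` is separable, and the
automorphisms of its splitting field `L` act on its roots through the Galois group of `P`. -/
theorem exists_gal_equivariant_roots {F K : Type*} [Field F] [Field K] {P : F[X]}
    (hP : P.Separable) (ι : F →+* K) {N : K[X]} (hN : N ≠ 0) (hdeg : N.natDegree ≤ P.natDegree)
    (θ : AlgebraicClosure K → AlgebraicClosure K) (hθ : Function.Injective θ)
    (hσθ : ∀ (σ : AlgebraicClosure K ≃ₐ[K] AlgebraicClosure K) x, θ (σ x) = σ (θ x))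
    (hroot : ∀ x, P.eval₂ ((algebraMap K (AlgebraicClosure K)).comp ι) x = 0 →
      aeval (θ x) N = 0) :
    N.Separable ∧ ∃ (L : IntermediateField K (AlgebraicClosure K))
      (Ψ : P.rootSet P.SplittingField → L), FiniteDimensional K L ∧ IsGalois K L ∧
      (N.map (algebraMap K L)).Splits ∧ Function.Injective Ψ ∧
      (∀ x : L, aeval x N = 0 ↔ x ∈ Set.range Ψ) ∧
      ∀ σ : L ≃ₐ[K] L, ∃ g : P.Gal, ∀ x, Ψ (g • x) = σ (Ψ x) := by
  classical
  obtain ⟨ε, hε, hgal⟩ := exists_gal_of_algEquiv P ι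
  let E := AlgebraicClosure K
  have hPne : P ≠ 0 := hP.ne_zero
  let ψ : P.rootSet P.SplittingField → E := fun x => θ (ε x)
  have hψ : Function.Injective ψ := fun x y h => Subtype.ext (ε.injective (hθ h))
  have hψroot : ∀ x, ψ x ∈ N.rootSet E := by
    intro x
    rw [mem_rootSet]
    refine ⟨hN, hroot _ ?_⟩
    have hc : (algebraMap K E).comp ι = ε.comp (algebraMap F P.SplittingField) :=
      RingHom.ext fun a => (hε a).symm
    rw [hc, ← hom_eval₂, ← aeval_def, (mem_rootSet.mp x.2).2, map_zero]
  have hcardP : Fintype.card (P.rootSet P.SplittingField) = P.natDegree :=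
    card_rootSet_eq_natDegree hP (SplittingField.splits P)
  let ψ' : P.rootSet P.SplittingField → N.rootSet E := fun x => ⟨ψ x, hψroot x⟩
  have hψ' : Function.Injective ψ' := fun x y h => hψ (congrArg Subtype.val h)
  have hle1 := Fintype.card_le_of_injective ψ' hψ'
  have hle2 : Fintype.card (N.rootSet E) ≤ (N.map (algebraMap K E)).roots.card := by
    rw [Fintype.card_of_subtype (N.aroots E).toFinset (by simp [rootSet])]
    exact Multiset.toFinset_card_le _
  have hle3 : (N.map (algebraMap K E)).roots.card ≤ N.natDegree :=
    (card_roots' _).trans natDegree_map_le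
  have hsurj : Function.Surjective ψ' :=
    ((Fintype.bijective_iff_injective_and_card ψ').mpr ⟨hψ', by omega⟩).2
  have hsep : N.Separable := by
    rw [← nodup_aroots_iff_of_splits hN (IsAlgClosed.splits (N.map (algebraMap K E))),
      ← Multiset.toFinset_card_eq_card_iff_nodup]
    have : Fintype.card (N.rootSet E) = (N.aroots E).toFinset.card :=
      Fintype.card_of_subtype (N.aroots E).toFinset (by simp [rootSet])
    have : (N.aroots E).card ≤ N.natDegree := hle3
    have := Multiset.toFinset_card_le (N.aroots E)
    omega
  refine ⟨hsep, ?_⟩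
  let L : IntermediateField K E := IntermediateField.adjoin K (N.rootSet E)
  have hsf : IsSplittingField K L N :=
    IntermediateField.adjoin_rootSet_isSplittingField (IsAlgClosed.splits _)
  have hfin : FiniteDimensional K L := IsSplittingField.finiteDimensional L N
  have hgalL : IsGalois K L := IsGalois.of_separable_splitting_field hsep
  have hmemL : ∀ x, ψ x ∈ L := fun x => IntermediateField.subset_adjoin K _ (hψroot x)
  refine ⟨L, fun x => ⟨ψ x, hmemL x⟩, hfin, hgalL, hsf.splits, fun x y h => hψ ?_, fun x => ?_,
    fun σ => ?_⟩
  · exact congrArg Subtype.val h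
  · have e : ((aeval x N : L) : E) = aeval (x : E) N := by
      rw [← IntermediateField.coe_val L, ← aeval_algHom_apply]
    have : aeval x N = 0 ↔ (x : E) ∈ N.rootSet E := by
      rw [mem_rootSet, ← e, ZeroMemClass.coe_eq_zero]
      exact ⟨fun h => ⟨hN, h⟩, fun h => h.2⟩
    rw [this]
    constructor
    · intro h
      obtain ⟨y, hy⟩ := hsurj ⟨x, h⟩
      exact ⟨y, Subtype.ext (congrArg (fun z : N.rootSet E => (z : E)) hy)⟩
    · rintro ⟨y, rfl⟩
      exact hψroot y
  · obtain ⟨g, hg⟩ := hgal (σ.liftNormal E)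
    refine ⟨g, fun x => Subtype.ext ?_⟩
    change θ (ε (g • x : P.rootSet P.SplittingField)) = ((σ ⟨ψ x, hmemL x⟩ : L) : E)
    rw [hg, hσθ]
    exact σ.liftNormal_commutes E ⟨ψ x, hmemL x⟩

/-- The Galois group of `P` contains a transposition of two roots. -/
abbrev HasGalTransposition {F : Type*} [Field F] (P : F[X]) : Prop :=
  ∃ (g : P.Gal) (a b : P.rootSet P.SplittingField), a ≠ b ∧ g • a = b ∧ g • b = a ∧
    ∀ x, x ≠ a → x ≠ b → g • x = x

open Pointwise in
/-- There is a set of `j` roots of `P` whose setwise stabilizer in the Galois group permutes the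
other roots transitively. -/
abbrev HasTransitiveGalOff {F : Type*} [Field F] (P : F[X]) (j : ℕ) : Prop :=
  ∃ S : Set (P.rootSet P.SplittingField), S.ncard = j ∧
    ∀ x ∉ S, ∀ y ∉ S, ∃ g : P.Gal, g • S = S ∧ g • x = y

variable {F A K κ : Type*} [Field F] [CommRing A] [IsDomain A] [IsIntegrallyClosed A] [Field K]
  [Algebra A K] [IsFractionRing A K] [Field κ]

/-- The transposition of `exists_swap_of_double_root`, inside the Galois group of a polynomial `P`
over a smaller field. -/
theorem exists_gal_swap {P : F[X]} (hP : P.Separable) (ι : F →+* K) {N : A[X]} (hN : N.Monic)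
    (hdeg : N.natDegree ≤ P.natDegree)
    (θ : AlgebraicClosure K → AlgebraicClosure K) (hθ : Function.Injective θ)
    (hσθ : ∀ (σ : AlgebraicClosure K ≃ₐ[K] AlgebraicClosure K) x, θ (σ x) = σ (θ x))
    (hroot : ∀ x, P.eval₂ ((algebraMap K (AlgebraicClosure K)).comp ι) x = 0 →
      (N.map (algebraMap A (AlgebraicClosure K))).eval (θ x) = 0)
    (φ : A →+* κ) (hφ : ∀ z : κ, ∃ a b, φ b ≠ 0 ∧ z = φ a / φ b)
    {x₀ π u v : A} (hπ : π ≠ 0) (hπ0 : φ π = 0)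
    (hu : N.eval x₀ = π ^ 2 * u) (hv : N.derivative.eval x₀ = π ^ 2 * v) {h : κ[X]}
    (hred : N.map φ = (X - C (φ x₀)) ^ 2 * h) (h0 : h.eval (φ x₀) ≠ 0) (hhsep : h.Separable)
    (hhs : h.Splits) (h2 : (2 : κ) ≠ 0)
    (hc : ∀ z : κ, z ^ 2 ≠ -4 * h.eval (φ x₀) ^ 3 * φ u) :
    HasGalTransposition P := by
  obtain ⟨hsep, L, Ψ, _, _, hs, hinj, hrange, hlift⟩ := exists_gal_equivariant_roots hP ι
    (hN.map (algebraMap A K)).ne_zero (natDegree_map_le.trans hdeg) θ hθ hσθ (fun x hx => by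
      rw [aeval_def, ← eval_map, Polynomial.map_map, ← IsScalarTower.algebraMap_eq]
      exact hroot x hx)
  rw [Polynomial.map_map, ← IsScalarTower.algebraMap_eq] at hs
  obtain ⟨σ, α, β, hα, hβ, hne, hσα, hσβ, hfix⟩ :=
    exists_swap_of_double_root (K := K) (L := L) φ hφ hN hs hsep hπ hπ0 hu hv hred h0 hhsep hhs
      h2 hc
  simp only [aeval_map_algebraMap] at hrange
  obtain ⟨a, rfl⟩ := (hrange α).mp hα
  obtain ⟨b, rfl⟩ := (hrange β).mp hβ
  obtain ⟨g, hg⟩ := hlift σ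
  refine ⟨g, a, b, fun h => hne (congrArg Ψ h), hinj ((hg a).trans hσα),
    hinj ((hg b).trans hσβ), fun x hxa hxb => hinj ((hg x).trans (hfix _ ?_ ?_ ?_))⟩
  · exact (hrange _).mpr ⟨x, rfl⟩
  · exact fun h => hxa (hinj h)
  · exact fun h => hxb (hinj h)

open Pointwise in
/-- The transitivity of `exists_transitive_off_small_set`, inside the Galois group of a polynomial
`P` over a smaller field. -/
theorem exists_gal_transitive_off_small_set {P : F[X]} (hP : P.Separable) (ι : F →+* K) {N : A[X]}
    (hN : N.Monic) (hdeg : N.natDegree ≤ P.natDegree)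
    (θ : AlgebraicClosure K → AlgebraicClosure K) (hθ : Function.Injective θ)
    (hσθ : ∀ (σ : AlgebraicClosure K ≃ₐ[K] AlgebraicClosure K) x, θ (σ x) = σ (θ x))
    (hroot : ∀ x, P.eval₂ ((algebraMap K (AlgebraicClosure K)).comp ι) x = 0 →
      (N.map (algebraMap A (AlgebraicClosure K))).eval (θ x) = 0)
    (φ : A →+* κ) (hφ : ∀ z : κ, ∃ a b, φ b ≠ 0 ∧ z = φ a / φ b) {j : ℕ} {q : κ[X]}
    (hq : N.map φ = X ^ j * q) (hirr : Irreducible q) (hqsep : q.Separable) (hq0 : q.eval 0 ≠ 0) :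
    HasTransitiveGalOff P j := by
  obtain ⟨hsep, L, Ψ, _, _, hs, hinj, hrange, hlift⟩ := exists_gal_equivariant_roots hP ι
    (hN.map (algebraMap A K)).ne_zero (natDegree_map_le.trans hdeg) θ hθ hσθ (fun x hx => by
      rw [aeval_def, ← eval_map, Polynomial.map_map, ← IsScalarTower.algebraMap_eq]
      exact hroot x hx)
  rw [Polynomial.map_map, ← IsScalarTower.algebraMap_eq] at hs
  obtain ⟨S, hS, hcard, htr⟩ :=
    exists_transitive_off_small_set (K := K) (L := L) φ hφ hN hs hsep hq hirr hqsep hq0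
  simp only [aeval_map_algebraMap] at hrange
  have hSr : S ⊆ Set.range Ψ := fun x hx => (hrange x).mp (hS hx)
  refine ⟨Ψ ⁻¹' S, ?_, fun x hx y hy => ?_⟩
  · rw [Set.ncard_preimage_of_injective_subset_range hinj hSr, hcard]
  · obtain ⟨σ, hσS, hσx⟩ := htr (Ψ x) (Ψ y) ((hrange _).mpr ⟨x, rfl⟩) hx
      ((hrange _).mpr ⟨y, rfl⟩) hy
    obtain ⟨g, hg⟩ := hlift σ
    refine ⟨g, ?_, hinj ((hg x).trans hσx)⟩
    refine Set.eq_of_subset_of_ncard_le ?_ (Set.ncard_smul_set g _).ge (Set.toFinite _)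
    rintro _ ⟨s, hs, rfl⟩
    change Ψ (g • s) ∈ S
    rw [hg, ← hσS]
    exact ⟨_, hs, rfl⟩

/-- The Galois group of an irreducible polynomial of degree `d` is the symmetric group when it
contains a transposition and, unless `d` is prime, elements that are transitive off a small set
of roots. -/
theorem generatesSymmetricExtension_of_swap [CharZero F] {P : F[X]} {d : ℕ} (hirr : Irreducible P)
    (hdeg : P.natDegree = d)
    (hswap : HasGalTransposition P)
    (hprim : MulAction.IsPretransitive P.Gal (P.rootSet P.SplittingField) →
      Nat.card (P.rootSet P.SplittingField) = d →
      MulAction.IsPreprimitive P.Gal (P.rootSet P.SplittingField)) :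
    GeneratesSymmetricExtension P d := by
  classical
  have htrans : MulAction.IsPretransitive P.Gal (P.rootSet P.SplittingField) := by
    refine ⟨fun x y => ?_⟩
    have hx := minpoly.eq_of_irreducible hirr (mem_rootSet.mp x.2).2
    have hy := minpoly.eq_of_irreducible hirr (mem_rootSet.mp y.2).2
    obtain ⟨g, hg⟩ := (Normal.minpoly_eq_iff_mem_orbit P.SplittingField).mp (hy.symm.trans hx)
    exact ⟨g, Subtype.ext hg⟩
  have hprim' := hprim htrans (by
    rw [Nat.card_eq_fintype_card, ← hdeg]
    exact card_rootSet_eq_natDegree hirr.separable (SplittingField.splits P))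
  refine generatesSymmetricExtension_of_surjective hirr hdeg fun p => ?_
  let G : Subgroup (Equiv.Perm (P.rootSet P.SplittingField)) :=
    (MulAction.toPermHom P.Gal (P.rootSet P.SplittingField)).range
  have hG : MulAction.IsPreprimitive G (P.rootSet P.SplittingField) := by
    let φ : P.Gal → G := (MulAction.toPermHom P.Gal (P.rootSet P.SplittingField)).rangeRestrict
    let f : P.rootSet P.SplittingField →ₑ[φ] P.rootSet P.SplittingField :=
      { toFun := id, map_smul' := fun _ _ => rfl }
    exact MulAction.IsPreprimitive.of_surjective (f := f) Function.surjective_id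
  obtain ⟨g, a, b, hab, hga, hgb, hfix⟩ := hswap
  have htop : G = ⊤ := by
    refine Equiv.Perm.subgroup_eq_top_of_isPreprimitive_of_isSwap_mem hG
      (MulAction.toPermHom P.Gal _ g) ⟨a, b, hab, ?_⟩ ⟨g, rfl⟩
    ext1 x
    rw [MulAction.toPermHom_apply, MulAction.toPerm_apply]
    by_cases hxa : x = a
    · rw [hxa, hga, Equiv.swap_apply_left]
    by_cases hxb : x = b
    · rw [hxb, hgb, Equiv.swap_apply_right]
    rw [hfix x hxa hxb, Equiv.swap_apply_of_ne_of_ne hxa hxb]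
  obtain ⟨σ, hσ⟩ : p ∈ G := htop ▸ Subgroup.mem_top p
  exact ⟨σ, fun x => Equiv.congr_fun hσ x⟩

end Transport

/-! ### Valuation rings of algebraic numbers and the Gauss valuation -/

section ValuationRings

open Polynomial IsLocalRing

/-- For every prime number `q`, the algebraic numbers have a valuation ring over `q`. -/
theorem exists_valuationSubring_residue_eq_zero {q : ℕ} (hq : q.Prime) :
    ∃ V : ValuationSubring (AlgebraicClosure ℚ), residue V (q : V) = 0 := by
  let A : Subring (AlgebraicClosure ℚ) := (Int.castRingHom (AlgebraicClosure ℚ)).range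
  let e : ℤ ≃+* A := RingEquiv.ofBijective (Int.castRingHom (AlgebraicClosure ℚ)).rangeRestrict
    ⟨fun a b h => by
      have := congrArg (Subtype.val) h
      simpa using this, (Int.castRingHom (AlgebraicClosure ℚ)).rangeRestrict_surjective⟩
  let I : Ideal A := Ideal.span {(q : A)}
  have hI : I ≠ ⊤ := by
    rw [Ne, Ideal.span_singleton_eq_top]
    intro h
    have h' := h.map e.symm
    rw [map_natCast, Int.isUnit_iff] at h'
    have := hq.one_lt
    omega
  obtain ⟨V, -, hV⟩ := Ideal.image_subset_nonunits_valuationSubring I hI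
  refine ⟨V, ?_⟩
  rw [residue_eq_zero_iff]
  have : ((q : V) : AlgebraicClosure ℚ) ∈ V.nonunits :=
    hV ⟨(q : A), Ideal.subset_span rfl, by simp⟩
  exact (ValuationSubring.coe_mem_nonunits_iff).mp this

variable (V : ValuationSubring (AlgebraicClosure ℚ))

/-- Roots of the reduction of a monic polynomial lift, without any simplicity assumption. -/
theorem exists_root_residue_eq {p : V[X]} (hp : p.Monic) {ξ : ResidueField V}
    (hξ : (p.map (residue V)).eval ξ = 0) : ∃ x : V, p.eval x = 0 ∧ residue V x = ξ := by
  have : IsIntegrallyClosedIn V (AlgebraicClosure ℚ) :=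
    (isIntegrallyClosed_iff_isIntegrallyClosedIn _).mp inferInstance
  obtain ⟨R, hR, -⟩ := exists_eq_prod_X_sub_C (L := AlgebraicClosure ℚ) hp (IsAlgClosed.splits _)
  rw [hR, Polynomial.map_multiset_prod, Multiset.map_map, ← coe_evalRingHom, map_multiset_prod,
    Multiset.prod_eq_zero_iff, Multiset.map_map, Multiset.mem_map] at hξ
  obtain ⟨x, hx, h⟩ := hξ
  refine ⟨x, ?_, ?_⟩
  · rw [hR, ← coe_evalRingHom, map_multiset_prod, Multiset.prod_eq_zero_iff, Multiset.map_map,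
      Multiset.mem_map]
    exact ⟨x, hx, by simp⟩
  · simp at h
    exact (sub_eq_zero.mp h).symm

theorem exists_pow_eq_valuationSubring (a : V) {n : ℕ} (hn : n ≠ 0) : ∃ x : V, x ^ n = a := by
  obtain ⟨x, hx⟩ := IsAlgClosed.exists_pow_nat_eq (a : AlgebraicClosure ℚ) (Nat.pos_of_ne_zero hn)
  have : x ∈ V := by
    have h : x ^ n ∈ V := hx ▸ a.2
    rw [← ValuationSubring.valuation_le_one_iff] at h ⊢
    rw [map_pow] at h
    exact (pow_le_one_iff hn).mp h
  exact ⟨⟨x, this⟩, Subtype.ext hx⟩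

instance isAlgClosed_residueField_valuationSubring : IsAlgClosed (ResidueField V) := by
  refine IsAlgClosed.of_exists_root _ fun p hp hirr => ?_
  obtain ⟨P, hP, hdeg, hPm⟩ := lifts_and_degree_eq_and_monic
    ((lifts_iff_coeff_lifts (f := residue V) p).mpr fun n => residue_surjective _) hp
  have h0 : (P.map (algebraMap V (AlgebraicClosure ℚ))).degree ≠ 0 := by
    rw [hPm.degree_map, hdeg]
    exact (degree_pos_of_irreducible hirr).ne'
  have : IsIntegrallyClosedIn V (AlgebraicClosure ℚ) :=
    (isIntegrallyClosed_iff_isIntegrallyClosedIn _).mp inferInstance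
  obtain ⟨R, hR, -⟩ := exists_eq_prod_X_sub_C (L := AlgebraicClosure ℚ) hPm (IsAlgClosed.splits _)
  obtain ⟨x, hx⟩ : ∃ x, x ∈ R := by
    refine Multiset.exists_mem_of_ne_zero fun h => ?_
    rw [h] at hR
    simp [hR] at h0
  refine ⟨residue V x, ?_⟩
  have : P.eval x = 0 := by
    rw [hR, ← coe_evalRingHom, map_multiset_prod, Multiset.prod_eq_zero_iff, Multiset.map_map,
      Multiset.mem_map]
    exact ⟨x, hx, by simp⟩
  rw [← hP, eval_map, eval₂_at_apply, this, map_zero]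

/-- Reduction of the coefficients, as a map `V[X] → k(X)`: the residue map of the Gauss
valuation. -/
noncomputable def gaussResidue : V[X] →+* RatFunc (ResidueField V) :=
  (algebraMap (ResidueField V)[X] (RatFunc (ResidueField V))).comp (mapRingHom (residue V))

@[simp]
theorem gaussResidue_C (a : V) : gaussResidue V (C a) = RatFunc.C (residue V a) := by
  simp [gaussResidue]

@[simp]
theorem gaussResidue_X : gaussResidue V X = RatFunc.X := by
  simp [gaussResidue]

theorem gaussResidue_comp_C :
    (gaussResidue V).comp C = (RatFunc.C).comp (residue V) :=
  RingHom.ext fun a => gaussResidue_C V a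

theorem exists_gaussResidue_div (z : RatFunc (ResidueField V)) :
    ∃ a b, gaussResidue V b ≠ 0 ∧ z = gaussResidue V a / gaussResidue V b := by
  have hsurj := map_surjective _ (residue_surjective (R := V))
  obtain ⟨a, ha⟩ := hsurj z.num
  obtain ⟨b, hb⟩ := hsurj z.denom
  have e : ∀ c, gaussResidue V c = algebraMap _ _ (c.map (residue V)) := fun c => rfl
  refine ⟨a, b, ?_, ?_⟩
  · rw [e, hb]
    exact RatFunc.algebraMap_ne_zero z.denom_ne_zero
  · rw [e, e, ha, hb, RatFunc.num_div_denom]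

end ValuationRings

section RationalFunctions

open Polynomial

variable {k : Type*} [Field k]

theorem RatFunc.intDegree_pow' {z : RatFunc k} (hz : z ≠ 0) (n : ℕ) :
    (z ^ n).intDegree = n * z.intDegree := by
  induction n with
  | zero => simp
  | succ n ih =>
    rw [pow_succ, RatFunc.intDegree_mul (pow_ne_zero n hz) hz, ih]
    push_cast
    ring

theorem RatFunc.sq_ne_C_mul_X {c : k} (hc : c ≠ 0) (z : RatFunc k) :
    z ^ 2 ≠ RatFunc.C c * RatFunc.X := by
  intro h
  have hC : RatFunc.C c ≠ 0 := (_root_.map_ne_zero _).mpr hc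
  have hz : z ≠ 0 := by
    rintro rfl
    rw [zero_pow two_ne_zero] at h
    exact mul_ne_zero hC RatFunc.X_ne_zero h.symm
  have := congrArg RatFunc.intDegree h
  rw [RatFunc.intDegree_pow' hz, RatFunc.intDegree_mul hC RatFunc.X_ne_zero, RatFunc.intDegree_C,
    RatFunc.intDegree_X] at this
  push_cast at this
  omega

theorem RatFunc.irreducible_X_pow_sub_C_mul_X_sq {c : k} (hc : c ≠ 0) {n : ℕ} (hn : Odd n) :
    Irreducible (Polynomial.X ^ n - Polynomial.C (RatFunc.C c * RatFunc.X ^ 2) : (RatFunc k)[X]) := by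
  refine X_pow_sub_C_irreducible_of_odd hn fun p hp hpn z h => ?_
  have hC : RatFunc.C c ≠ 0 := (_root_.map_ne_zero _).mpr hc
  have hX : (RatFunc.X : RatFunc k) ^ 2 ≠ 0 := pow_ne_zero _ RatFunc.X_ne_zero
  have hz : z ≠ 0 := by
    rintro rfl
    rw [zero_pow hp.ne_zero] at h
    exact mul_ne_zero hC hX h.symm
  have := congrArg RatFunc.intDegree h
  rw [RatFunc.intDegree_pow' hz, RatFunc.intDegree_mul hC hX, RatFunc.intDegree_C,
    RatFunc.intDegree_pow' RatFunc.X_ne_zero, RatFunc.intDegree_X] at this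
  have hp2 : (p : ℤ) ∣ (2 : ℕ) := ⟨z.intDegree, by rw [this]; norm_num⟩
  rw [Int.natCast_dvd_natCast] at hp2
  have := (Nat.prime_dvd_prime_iff_eq hp Nat.prime_two).mp hp2
  rw [this] at hpn
  exact (Nat.not_even_iff_odd.mpr hn) (even_iff_two_dvd.mpr hpn)

end RationalFunctions

section Parameter

open Polynomial

variable (V : ValuationSubring (AlgebraicClosure ℚ)) (K : Type*) [Field K] [CharZero K]
  [Algebra V[X] K]

theorem isAlgebraic_algebraMap_valuationSubring (a : V) :
    IsAlgebraic ℚ (algebraMap V[X] K (C a)) := by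
  rw [← IsFractionRing.isAlgebraic_iff ℤ ℚ]
  obtain ⟨p, hp, h⟩ := (IsFractionRing.isAlgebraic_iff ℤ ℚ (AlgebraicClosure ℚ)).mpr
    ((AlgebraicClosure.isAlgebraic ℚ).isAlgebraic (a : AlgebraicClosure ℚ))
  refine ⟨p, hp, ?_⟩
  have h' : aeval a p = 0 := by
    apply Subtype.val_injective
    change algebraMap V (AlgebraicClosure ℚ) (aeval a p) = 0
    rw [← aeval_algebraMap_apply]
    exact h
  have : algebraMap V[X] K (C a) = (((algebraMap V[X] K).comp C).toIntAlgHom) a := rfl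
  rw [this, aeval_algHom_apply, h', map_zero]

theorem transcendental_algebraMap_X [IsFractionRing V[X] K] :
    Transcendental ℚ (algebraMap V[X] K X) := by
  rw [Transcendental, ← IsFractionRing.isAlgebraic_iff ℤ ℚ]
  rintro ⟨p, hp, h⟩
  have e : algebraMap V[X] K X = (algebraMap V[X] K).toIntAlgHom X := rfl
  rw [e, aeval_algHom_apply] at h
  have h' : aeval (X : V[X]) p = 0 := IsFractionRing.injective V[X] K (h.trans (map_zero _).symm)
  have h'' : p.map (algebraMap ℤ V) = 0 := by
    rw [← h', aeval_def, eval₂_eq_eval_map, ← eval₂_C_X (p := p.map (algebraMap ℤ V)),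
      eval₂_eq_eval_map, Polynomial.map_map]
    rfl
  exact hp ((Polynomial.map_eq_zero_iff (RingHom.injective_int (algebraMap ℤ V))).mp h'')

/-- Any transcendental element of a field of characteristic zero defines an embedding of `ℚ(t)`. -/
theorem exists_ratFunc_ringHom {K : Type*} [Field K] [CharZero K] {T : K}
    (hT : Transcendental ℚ T) : ∃ ι : RatFunc ℚ →+* K, ι RatFunc.X = T := by
  have hinj : Function.Injective (aeval (R := ℚ) T : ℚ[X] →ₐ[ℚ] K).toRingHom :=
    transcendental_iff_injective.mp hT
  refine ⟨IsFractionRing.lift hinj, ?_⟩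
  rw [← RatFunc.algebraMap_X, IsFractionRing.lift_algebraMap]
  simp

end Parameter

/-! ### Reduction of one-parameter families -/

section GaussValuation

open Polynomial IsLocalRing

variable (V : ValuationSubring (AlgebraicClosure ℚ)) {K : Type*} [Field K] [Algebra V[X] K]
  [IsFractionRing V[X] K]

/-- A polynomial `P` over `ℚ(t)` whose roots correspond, after a change of variables over
`K = Frac V[s]`, to the solutions `x` of `g(x) = (e x + T)²`, has a transposition in its Galois
group as soon as `x₀` is a critical point for `T = T₀` that is a simple one after reduction
to the residue field of `V`, and the only one with its critical value: take `T = T₀ + π² s` with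
`π` in the maximal ideal. Since constants are algebraically closed in the residue field `k(s)` of
the Gauss valuation, the only ramification seen there is that of the square root of `s`. -/
theorem exists_gal_swap_of_critical_point (h2 : (2 : ResidueField V) ≠ 0) {π : V} (hπ : π ≠ 0)
    (hπ0 : residue V π = 0) {F : Type*} [Field F] {P : F[X]} (hP : P.Separable) {g : V[X]}
    (hg : g.Monic) (hdeg : g.natDegree = P.natDegree) (hdeg2 : 2 < g.natDegree) {e x₀ y₀ : V}
    (hx : g.eval x₀ = y₀ ^ 2) (hx' : g.derivative.eval x₀ = 2 * e * y₀) (hy : residue V y₀ ≠ 0)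
    {h : (ResidueField V)[X]}
    (hh : g.map (residue V) - (C (residue V e) * X + C (residue V (y₀ - e * x₀))) ^ 2 =
      (X - C (residue V x₀)) ^ 2 * h)
    (h0 : h.eval (residue V x₀) ≠ 0) (hsep : h.Separable) (ι : F →+* K)
    (θ : AlgebraicClosure K → AlgebraicClosure K) (hθ : Function.Injective θ)
    (hσθ : ∀ (σ : AlgebraicClosure K ≃ₐ[K] AlgebraicClosure K) x, θ (σ x) = σ (θ x))
    (hroot : ∀ x, P.eval₂ ((algebraMap K (AlgebraicClosure K)).comp ι) x = 0 →
      g.eval₂ ((algebraMap V[X] (AlgebraicClosure K)).comp C) (θ x) =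
        (algebraMap V[X] _ (C e) * θ x +
          algebraMap V[X] _ (C (y₀ - e * x₀) + C (π ^ 2) * X)) ^ 2) :
    HasGalTransposition P := by
  let T : V[X] := C (y₀ - e * x₀) + C (π ^ 2) * X
  let l : V[X][X] := C (C e) * X + C T
  let N : V[X][X] := g.map C - l ^ 2
  have hl : (l ^ 2).natDegree ≤ 2 :=
    natDegree_pow_le.trans (by
      have : l.natDegree ≤ 1 := natDegree_linear_le
      omega)
  have hlt : (l ^ 2).degree < (g.map C : V[X][X]).degree := by
    refine degree_lt_degree (hl.trans_lt ?_)
    rwa [hg.natDegree_map]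
  have hNm : N.Monic := (hg.map C).sub_of_left hlt
  have hNdeg : N.natDegree = g.natDegree := by
    rw [natDegree_sub_eq_left_of_natDegree_lt, hg.natDegree_map]
    rw [hg.natDegree_map]
    omega
  have hφ0 : gaussResidue V T = RatFunc.C (residue V (y₀ - e * x₀)) := by
    simp only [T, map_add, map_mul, map_pow, gaussResidue_C, gaussResidue_X, hπ0]
    simp
  refine exists_gal_swap hP ι hNm (hNdeg.trans hdeg).le θ hθ hσθ (fun x hx => ?_)
    (gaussResidue V) (exists_gaussResidue_div V) (x₀ := C x₀) (π := C π)
    (u := -(2 * C y₀ * X + C π ^ 2 * X ^ 2)) (v := -(2 * C e * X)) (h := h.map RatFunc.C)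
    (C_ne_zero.mpr hπ) (by rw [gaussResidue_C, hπ0, map_zero]) ?_ ?_ ?_ ?_ hsep.map
    ((IsAlgClosed.splits h).map _) ?_ ?_
  · have := hroot x hx
    simp only [N, l, Polynomial.map_sub, Polynomial.map_pow, Polynomial.map_add,
      Polynomial.map_mul, map_C, map_X, Polynomial.map_map, eval_sub, eval_pow, eval_add, eval_mul,
      eval_C, eval_X]
    rw [eval_map, this, sub_self]
  · simp only [N, l, T, eval_sub, eval_pow, eval_add, eval_mul, eval_C, eval_X, eval_map,
      eval₂_at_apply, hx, map_sub, map_mul, map_pow]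
    ring
  · simp only [N, l, T, derivative_pow, derivative_add, derivative_mul,
      derivative_C, derivative_X, derivative_map, eval_sub, eval_pow, eval_add, eval_mul, eval_C,
      eval_X, eval_map, eval₂_at_apply, hx', map_sub, map_mul, map_pow, map_ofNat]
    simp
    ring
  · have e1 : N.map (gaussResidue V) = (g.map (residue V) - (C (residue V e) * X +
        C (residue V (y₀ - e * x₀))) ^ 2).map RatFunc.C := by
      simp only [N, l, Polynomial.map_sub, Polynomial.map_pow, Polynomial.map_add,
        Polynomial.map_mul, map_C, map_X, Polynomial.map_map, gaussResidue_comp_C, hφ0,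
        gaussResidue_C]
    rw [e1, hh, gaussResidue_C]
    simp
  · rw [gaussResidue_C, eval_map, eval₂_at_apply]
    exact (_root_.map_ne_zero _).mpr h0
  · rw [← map_ofNat RatFunc.C 2]
    exact (_root_.map_ne_zero _).mpr h2
  · intro z hz
    refine RatFunc.sq_ne_C_mul_X (c := 8 * h.eval (residue V x₀) ^ 3 * residue V y₀) ?_ z ?_
    · have : (8 : ResidueField V) = 2 ^ 3 := by norm_num
      rw [this]
      exact mul_ne_zero (mul_ne_zero (pow_ne_zero _ h2) (pow_ne_zero _ h0)) hy
    · rw [hz, gaussResidue_C, eval_map, eval₂_at_apply]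
      simp only [map_neg, map_add, map_mul, map_pow, map_ofNat, gaussResidue_C, gaussResidue_X, hπ0,
        map_zero]
      ring

open Pointwise in
/-- If the roots of `P` correspond, after a change of variables over `K = Frac V[s]`, to the
solutions of `x ^ d = s² m(x)` with `m` reducing to `b x ^ j`, then the elements of its Galois
group preserving some set of `j` roots are transitive on the `d - j` others: the latter reduce
to the solutions of `x ^ (d - j) = b s²`, an irreducible equation if `d - j` is odd. -/
theorem exists_gal_transitive_of_reduction {F : Type*} [Field F] {P : F[X]} (hP : P.Separable)
    {j n : ℕ} (hdeg : j + n = P.natDegree) (hn : Odd n) (hnV : (n : ResidueField V) ≠ 0)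
    {m : V[X]} (hm : m.natDegree < j + n) {b : ResidueField V} (hb : b ≠ 0)
    (hmb : m.map (residue V) = C b * X ^ j) (ι : F →+* K)
    (θ : AlgebraicClosure K → AlgebraicClosure K) (hθ : Function.Injective θ)
    (hσθ : ∀ (σ : AlgebraicClosure K ≃ₐ[K] AlgebraicClosure K) x, θ (σ x) = σ (θ x))
    (hroot : ∀ x, P.eval₂ ((algebraMap K (AlgebraicClosure K)).comp ι) x = 0 →
      θ x ^ (j + n) = algebraMap V[X] (AlgebraicClosure K) X ^ 2 *
        m.eval₂ ((algebraMap V[X] (AlgebraicClosure K)).comp C) (θ x)) :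
    HasTransitiveGalOff P j := by
  let r : V[X][X] := C (X ^ 2) * m.map C
  let N : V[X][X] := X ^ (j + n) - r
  have hr : r.natDegree < j + n :=
    (natDegree_C_mul_le _ _).trans_lt (natDegree_map_le.trans_lt hm)
  have hNm : N.Monic := (monic_X_pow _).sub_of_left (degree_lt_degree (by rwa [natDegree_X_pow]))
  have hNdeg : N.natDegree = j + n := by
    rw [natDegree_sub_eq_left_of_natDegree_lt (by rwa [natDegree_X_pow]), natDegree_X_pow]
  have hirr := RatFunc.irreducible_X_pow_sub_C_mul_X_sq hb hn
  have hc : RatFunc.C b * RatFunc.X ^ 2 ≠ 0 :=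
    mul_ne_zero ((_root_.map_ne_zero _).mpr hb) (pow_ne_zero _ RatFunc.X_ne_zero)
  refine exists_gal_transitive_off_small_set hP ι hNm (hNdeg.trans hdeg).le θ hθ hσθ
    (fun x hx => ?_) (gaussResidue V) (exists_gaussResidue_div V)
    (q := X ^ n - C (RatFunc.C b * RatFunc.X ^ 2)) ?_ hirr ?_ ?_
  · have := hroot x hx
    simp only [N, r, Polynomial.map_sub, Polynomial.map_pow, Polynomial.map_mul, map_C, map_X,
      Polynomial.map_map, eval_sub, eval_pow, eval_mul, eval_C, eval_X]
    rw [eval_map, this, map_pow, sub_self]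
  · have e1 : (m.map C).map (gaussResidue V) = C (RatFunc.C b) * X ^ j := by
      rw [Polynomial.map_map, gaussResidue_comp_C, ← Polynomial.map_map, hmb]
      simp
    simp only [N, r, Polynomial.map_sub, Polynomial.map_pow, Polynomial.map_mul, map_C, map_X, e1,
      map_pow, gaussResidue_X, C_mul]
    ring
  · refine separable_X_pow_sub_C _ ?_ hc
    rw [← map_natCast RatFunc.C]
    exact (_root_.map_ne_zero _).mpr hnV
  · simp only [eval_sub, eval_pow, eval_X, eval_C, zero_pow hn.pos.ne', zero_sub]
    exact neg_ne_zero.mpr hc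

/-- Factorization of a polynomial with a single double root. -/
theorem exists_separable_cofactor {k : Type*} [Field k] [IsAlgClosed k] {H : k[X]} {ξ : k}
    (h0 : H.eval ξ = 0) (h1 : H.derivative.eval ξ = 0) (h2 : H.derivative.derivative.eval ξ ≠ 0)
    (hrest : ∀ ρ, H.eval ρ = 0 → H.derivative.eval ρ = 0 → ρ = ξ) :
    ∃ h : k[X], H = (X - C ξ) ^ 2 * h ∧ h.eval ξ ≠ 0 ∧ h.Separable := by
  obtain ⟨h', rfl⟩ := dvd_iff_isRoot.mpr h0
  have h1' : h'.eval ξ = 0 := by simpa [derivative_mul] using h1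
  obtain ⟨h, rfl⟩ := dvd_iff_isRoot.mpr h1'
  have hne : h.eval ξ ≠ 0 := by
    intro h3
    apply h2
    simp [derivative_mul, h3]
  refine ⟨h, by ring, hne, ?_⟩
  rw [Polynomial.Separable, isCoprime_iff_aeval_ne_zero_of_isAlgClosed (K := k) k]
  intro ρ
  rw [coe_aeval_eq_eval]
  by_contra! hρ
  have : ρ = ξ := by
    refine hrest ρ ?_ ?_
    · simp [hρ.1]
    · simp [derivative_mul, hρ.1, hρ.2]
  exact hne (this ▸ hρ.1)

end GaussValuation

/-! ### Irreducibility -/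

section Irreducibility

open Polynomial

/-- A quadratic equation `a (y + b)² = g` over a factorial domain is irreducible if `a` and `g` are
relatively prime and `a g` is not a square. -/
theorem irreducible_C_mul_sq_sub_C {R : Type*} [CommRing R] [IsDomain R]
    [UniqueFactorizationMonoid R] {a g : R} (b : R) (ha : a ≠ 0) (hag : IsRelPrime a g)
    (hsq : ∀ w, w ^ 2 ≠ a * g) : Irreducible (C a * (X + C b) ^ 2 - C g : R[X]) := by
  set p : R[X] := C a * (X + C b) ^ 2 - C g with hp
  have hprim : p.IsPrimitive := by
    intro r hr
    have h1 : r ∣ g := by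
      obtain ⟨q, hq⟩ := hr
      have := congrArg (eval (-b)) hq
      simp only [hp, eval_sub, eval_mul, eval_pow, eval_add, eval_X, eval_C, neg_add_cancel] at this
      exact ⟨-q.eval (-b), by linear_combination -this⟩
    have h2 : r ∣ a := by
      have hc := (C_dvd_iff_dvd_coeff r p).mp hr 2
      have : p.coeff 2 = a := by
        rw [hp, coeff_sub, coeff_C_mul, coeff_C, if_neg two_ne_zero, sub_zero, coeff_X_add_C_pow]
        simp
      rwa [this] at hc
    exact hag h2 h1
  rw [hprim.irreducible_iff_irreducible_map_fraction_map (K := FractionRing R)]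
  set F := FractionRing R
  have hinj := IsFractionRing.injective R F
  have ha' : algebraMap R F a ≠ 0 := (map_ne_zero_iff _ hinj).mpr ha
  have hmap : p.map (algebraMap R F) =
      C (algebraMap R F a) * (X + C (algebraMap R F b)) ^ 2 - C (algebraMap R F g) := by
    simp [hp]
  apply irreducible_of_degree_le_three_of_not_isRoot
  · have : (p.map (algebraMap R F)).natDegree = 2 := by
      rw [hmap, natDegree_sub_C, natDegree_C_mul ha', natDegree_pow, natDegree_X_add_C, mul_one]
    rw [this]
    decide
  · intro z hz
    rw [IsRoot.def, hmap] at hz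
    simp only [eval_sub, eval_mul, eval_pow, eval_add, eval_X, eval_C] at hz
    have e : (algebraMap R F a * (z + algebraMap R F b)) ^ 2 = algebraMap R F (a * g) := by
      rw [map_mul]
      linear_combination algebraMap R F a * hz
    have hint : IsIntegral R (algebraMap R F a * (z + algebraMap R F b)) := by
      refine IsIntegral.of_pow two_pos ?_
      rw [e]
      exact isIntegral_algebraMap
    obtain ⟨w, hw⟩ := IsIntegrallyClosed.isIntegral_iff.mp hint
    rw [← hw, ← map_pow] at e
    exact hsq w (hinj e)

/-- Gauss's lemma turns irreducibility in the variable `t` over `k[x]` into irreducibility in the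
variable `x` over `k(t)`. -/
theorem irreducible_over_ratFunc {k : Type*} [Field k] (c : k →+* RatFunc k)
    (hc : c = (algebraMap k[X] (RatFunc k)).comp C) {a g : k[X]} (b : k[X]) (ha : a ≠ 0)
    (hag : IsCoprime a g) (hodd : Odd (a * g).natDegree)
    (hdeg : (a.map c * (C RatFunc.X + b.map c) ^ 2 - g.map c).natDegree ≠ 0) :
    Irreducible (a.map c * (C RatFunc.X + b.map c) ^ 2 - g.map c) := by
  have hirr := irreducible_C_mul_sq_sub_C b ha hag.isRelPrime (fun w hw => by
    rw [← hw, natDegree_pow] at hodd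
    exact (Nat.not_even_iff_odd.mpr hodd) (even_two_mul _))
  have hirr' := (MulEquiv.irreducible_iff (Bivariate.swap (R := k))).mpr hirr
  set q := Bivariate.swap (R := k) (C a * (X + C b) ^ 2 - C g) with hq
  have hmap : q.map (algebraMap k[X] (RatFunc k)) =
      a.map c * (C RatFunc.X + b.map c) ^ 2 - g.map c := by
    rw [hq, map_sub, map_mul, map_pow, map_add, Bivariate.swap_C, Bivariate.swap_C,
      Bivariate.swap_C, Bivariate.swap_Y, Polynomial.map_sub, Polynomial.map_mul,
      Polynomial.map_pow, Polynomial.map_add, Polynomial.map_map, Polynomial.map_map,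
      Polynomial.map_map, ← hc, map_C, RatFunc.algebraMap_X]
  rw [← hmap] at hdeg ⊢
  have hqdeg : q.natDegree ≠ 0 := by
    have := natDegree_map_le (f := algebraMap k[X] (RatFunc k)) (p := q)
    omega
  exact ((hirr'.isPrimitive hqdeg).irreducible_iff_irreducible_map_fraction_map).mp hirr'

variable {f : ℚ[X]}

theorem natDegree_pointPolynomial (hf : f.Monic) (hf3 : f.natDegree = 3) {d : ℕ} (hd : 3 ≤ d) :
    (pointPolynomial d f).natDegree = d := by
  have hfm : (f.map (algebraMap ℚ (RatFunc ℚ))).natDegree = 3 := by rw [natDegree_map, hf3]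
  have hX : (RatFunc.X : RatFunc ℚ) ^ 2 ≠ 0 := pow_ne_zero _ RatFunc.X_ne_zero
  unfold pointPolynomial
  split_ifs with h3 heven
  · rw [natDegree_sub_eq_left_of_natDegree_lt, hfm, h3]
    rw [hfm, natDegree_pow, natDegree_X_add_C]
    norm_num
  · have hd4 : 3 < d := lt_of_le_of_ne hd (Ne.symm h3)
    rw [natDegree_sub_eq_left_of_natDegree_lt, natDegree_C_mul_X_pow _ _ hX]
    rwa [hfm, natDegree_C_mul_X_pow _ _ hX]
  · rw [natDegree_sub_C, (monic_X_pow _).natDegree_mul (hf.map _), natDegree_X_pow, hfm]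
    omega

theorem irreducible_pointPolynomial (hf : f.Monic) (hf3 : f.natDegree = 3)
    {d : ℕ} (hd : 3 ≤ d) (h0 : d ≠ 3 → f.eval 0 ≠ 0) : Irreducible (pointPolynomial d f) := by
  have hdeg := natDegree_pointPolynomial hf hf3 hd
  have hc : algebraMap ℚ (RatFunc ℚ) = (algebraMap ℚ[X] (RatFunc ℚ)).comp C :=
    Subsingleton.elim _ _
  have hneg : ∀ {p q : (RatFunc ℚ)[X]}, p = -q → p.natDegree = d → (q.natDegree ≠ 0 → Irreducible q)
      → Irreducible p := by
    rintro p q rfl h hq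
    rw [natDegree_neg] at h
    exact (Associated.neg_left (Associated.refl q)).irreducible_iff.mpr (hq (by omega))
  rcases eq_or_ne d 3 with rfl | h3
  · refine hneg ?_ hdeg (irreducible_over_ratFunc _ hc (a := 1) (g := f) X one_ne_zero
      isCoprime_one_left (by rw [one_mul, hf3]; decide))
    simp only [pointPolynomial, if_true, Polynomial.map_one, map_X]
    rw [one_mul, neg_sub, add_comm X]
  rcases Nat.even_or_odd d with heven | hodd
  · have e : pointPolynomial d f = (X ^ d : ℚ[X]).map (algebraMap ℚ (RatFunc ℚ)) *
        (C RatFunc.X + (0 : ℚ[X]).map (algebraMap ℚ (RatFunc ℚ))) ^ 2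
        - f.map (algebraMap ℚ (RatFunc ℚ)) := by
      simp only [pointPolynomial, if_neg h3, if_pos heven, Polynomial.map_pow, map_X,
        Polynomial.map_zero, add_zero, map_pow]
      rw [mul_comm]
    have hirr := irreducible_over_ratFunc _ hc (a := X ^ d) (g := f) 0 (pow_ne_zero _ X_ne_zero) ?_ ?_
      (by rw [← e]; omega)
    · rw [e]
      exact hirr
    · refine IsCoprime.pow_left ((prime_X.irreducible.coprime_iff_not_dvd).mpr ?_)
      rw [X_dvd_iff, coeff_zero_eq_eval_zero]
      exact h0 h3
    · rw [(monic_X_pow _).natDegree_mul hf, natDegree_X_pow, hf3]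
      exact heven.add_odd (by decide)
  · refine hneg ?_ hdeg (irreducible_over_ratFunc _ hc (a := 1) (g := X ^ (d - 3) * f) 0 one_ne_zero
      isCoprime_one_left ?_)
    · simp only [pointPolynomial, if_neg h3, if_neg (Nat.not_even_iff_odd.mpr hodd),
        Polynomial.map_one, Polynomial.map_mul, Polynomial.map_pow, map_X, Polynomial.map_zero,
        map_pow]
      rw [one_mul, neg_sub, add_zero]
    · rw [one_mul, (monic_X_pow _).natDegree_mul hf, natDegree_X_pow, hf3]
      rwa [Nat.sub_add_cancel hd]

end Irreducibility

/-! ### Weierstrass models -/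

section Models

open Polynomial

/-- The cubic `(x - r)³ + A (x - r) + B`. -/
noncomputable def shiftedCubic (A B r : ℤ) : ℤ[X] := (X - C r) ^ 3 + C A * (X - C r) + C B

variable (A B r : ℤ)

theorem shiftedCubic_eq : shiftedCubic A B r =
    X ^ 3 + C (-3 * r) * X ^ 2 + C (3 * r ^ 2 + A) * X + C (-(r ^ 3 + A * r - B)) := by
  simp only [shiftedCubic, map_neg, map_mul, map_add, map_sub, map_pow, map_ofNat]
  ring

theorem shiftedCubic_monic : (shiftedCubic A B r).Monic := by
  rw [shiftedCubic_eq]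
  monicity!

theorem natDegree_shiftedCubic : (shiftedCubic A B r).natDegree = 3 := by
  rw [shiftedCubic_eq]
  compute_degree!

theorem shiftedCubic_coeff_zero : (shiftedCubic A B r).coeff 0 = -(r ^ 3 + A * r - B) := by
  rw [shiftedCubic_eq]
  simp only [coeff_add, coeff_C_mul, coeff_X_pow, coeff_X, coeff_C]
  simp

theorem shiftedCubic_coeff_one : (shiftedCubic A B r).coeff 1 = 3 * r ^ 2 + A := by
  rw [shiftedCubic_eq]
  simp only [coeff_add, coeff_C_mul, coeff_X_pow, coeff_X, coeff_C]
  simp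

theorem shiftedCubic_coeff_two : (shiftedCubic A B r).coeff 2 = -3 * r := by
  rw [shiftedCubic_eq]
  simp only [coeff_add, coeff_C_mul, coeff_X_pow, coeff_X, coeff_C]
  simp

/-- Every elliptic curve over `ℚ` has the models `y² = (x - r)³ + A (x - r) + B`, with `A`, `B`
divisible by a given integer. -/
theorem exists_isWeierstrassModel_shiftedCubic (E : WeierstrassCurve ℚ) [E.IsElliptic] {q : ℕ}
    (hq : q ≠ 0) : ∃ A B : ℤ, (q : ℤ) ∣ A ∧ (q : ℤ) ∣ B ∧ 4 * A ^ 3 + 27 * B ^ 2 ≠ 0 ∧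
      ∀ r : ℤ, IsWeierstrassModel E ((shiftedCubic A B r).map (Int.castRingHom ℚ)) := by
  let : Invertible (2 : ℚ) := invertibleOfNonzero two_ne_zero
  let : Invertible (3 : ℚ) := invertibleOfNonzero three_ne_zero
  obtain ⟨v, hv⟩ := E.exists_variableChange_isShortNF
  set W := v • E with hW
  set α := W.a₄
  set β := W.a₆
  let M : ℕ := q * α.den * β.den
  have hM : (M : ℚ) ≠ 0 := by
    simp [M, hq]
  let A : ℤ := q * (α.num * (q * β.den) ^ 3 * β.den * α.den ^ 3)
  let B : ℤ := q * (β.num * (q * α.den) ^ 5 * α.den * β.den ^ 5)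
  have hα : α * α.den = α.num := Rat.mul_den_eq_num α
  have hβ : β * β.den = β.num := Rat.mul_den_eq_num β
  have hA : (A : ℚ) = α * M ^ 4 := by
    simp only [A, M]
    push_cast
    rw [← hα]
    ring
  have hB : (B : ℚ) = β * M ^ 6 := by
    simp only [B, M]
    push_cast
    rw [← hβ]
    ring
  refine ⟨A, B, dvd_mul_right _ _, dvd_mul_right _ _, fun h => ?_, fun r => ?_⟩
  · have hΔ : W.Δ ≠ 0 := W.isUnit_Δ.ne_zero
    rw [W.Δ_of_isShortNF] at hΔ
    apply hΔ
    have h' : (4 * (A : ℚ) ^ 3 + 27 * (B : ℚ) ^ 2) = 0 := by exact_mod_cast h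
    rw [hA, hB] at h'
    have : (M : ℚ) ^ 12 * (4 * α ^ 3 + 27 * β ^ 2) = 0 := by linear_combination h'
    rw [(mul_eq_zero.mp this).resolve_left (pow_ne_zero _ hM), mul_zero]
  · refine ⟨(shiftedCubic_monic A B r).map _, ?_, ?_⟩
    · rw [(shiftedCubic_monic A B r).natDegree_map, natDegree_shiftedCubic]
    let u : ℚˣ := (Units.mk0 (M : ℚ) hM)⁻¹
    have hu : ((u⁻¹ : ℚˣ) : ℚ) = M := by simp [u]
    refine ⟨⟨u, -r / (M : ℚ) ^ 2, 0, 0⟩ * v, ?_⟩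
    rw [mul_smul, ← hW]
    ext
    · simp [WeierstrassCurve.variableChange_a₁]
    · simp only [WeierstrassCurve.variableChange_a₂, hu, W.a₁_of_isShortNF, W.a₂_of_isShortNF,
        coeff_map, shiftedCubic_coeff_two]
      field_simp
      simp
    · simp [WeierstrassCurve.variableChange_a₃]
    · simp only [WeierstrassCurve.variableChange_a₄, hu, W.a₁_of_isShortNF, W.a₂_of_isShortNF,
        W.a₃_of_isShortNF, coeff_map, shiftedCubic_coeff_one, eq_intCast]
      push_cast
      rw [hA]
      field_simp
      ring
    · simp only [WeierstrassCurve.variableChange_a₆, hu, W.a₁_of_isShortNF, W.a₂_of_isShortNF,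
        W.a₃_of_isShortNF, coeff_map, shiftedCubic_coeff_zero, eq_intCast]
      push_cast
      rw [hA, hB]
      field_simp
      ring

/-- A cubic without quadratic term has roots modulo infinitely many primes. -/
theorem exists_prime_dvd_cubic {M : ℤ} (hM : M ≠ 0) :
    ∃ p : ℕ, p.Prime ∧ ¬ (p : ℤ) ∣ M ∧ ∃ r : ℤ, (p : ℤ) ∣ r ^ 3 + A * r - B := by
  rcases eq_or_ne B 0 with rfl | hB
  · obtain ⟨p, hp, hpp⟩ := Nat.exists_infinite_primes (M.natAbs + 1)
    refine ⟨p, hpp, fun h => ?_, 0, by simp⟩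
    have := Nat.le_of_dvd (Int.natAbs_pos.mpr hM) (Int.natCast_dvd.mp h)
    omega
  -- At multiples `B M y` the cubic is `B` times an integer congruent to `-1` modulo `M`.
  · let y : ℤ := |A| + 2
    let w : ℤ := M * (y * (B ^ 2 * M ^ 2 * y ^ 2 + A)) - 1
    have hy : 2 ≤ y := by have := abs_nonneg A; simp only [y]; omega
    have hc : 1 ≤ B ^ 2 * M ^ 2 := by
      have h1 : 0 < B ^ 2 * M ^ 2 := by positivity
      omega
    have hbig : 2 ≤ B ^ 2 * M ^ 2 * y ^ 2 + A := by
      have h1 : y ^ 2 ≤ B ^ 2 * M ^ 2 * y ^ 2 := le_mul_of_one_le_left (sq_nonneg y) hc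
      have h2 : 2 * y ≤ y ^ 2 := by nlinarith
      have h3 := neg_abs_le A
      have h4 := abs_nonneg A
      simp only [y] at h1 h2 ⊢
      omega
    have hprod : 4 ≤ y * (B ^ 2 * M ^ 2 * y ^ 2 + A) := by nlinarith
    have hw : w.natAbs ≠ 1 := by
      intro h
      have hM1 : 1 ≤ |M| := Int.one_le_abs hM
      have h5 : 4 ≤ |M * (y * (B ^ 2 * M ^ 2 * y ^ 2 + A))| := by
        rw [abs_mul, abs_of_nonneg (by omega : 0 ≤ y * (B ^ 2 * M ^ 2 * y ^ 2 + A))]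
        nlinarith
      have h6 : w = 1 ∨ w = -1 := Int.natAbs_eq_iff.mp h
      simp only [w] at h6
      rw [le_abs] at h5
      omega
    obtain ⟨p, hp, hpw⟩ := Nat.exists_prime_and_dvd hw
    have hpw' : (p : ℤ) ∣ w := Int.natCast_dvd.mpr hpw
    refine ⟨p, hp, fun h => ?_, B * M * y, ?_⟩
    · have h1 : (p : ℤ) ∣ 1 := by
        have := dvd_sub (h.mul_right (y * (B ^ 2 * M ^ 2 * y ^ 2 + A))) hpw'
        simpa [w] using this
      exact hp.one_lt.ne' (by exact_mod_cast Int.eq_one_of_dvd_one (by positivity) h1)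
    · have : (B * M * y) ^ 3 + A * (B * M * y) - B = B * w := by simp only [w]; ring
      rw [this]
      exact hpw'.mul_left B

variable {A B}

/-- A shift `r` for which the constant coefficient of `shiftedCubic A B r` is divisible by some
prime `p` while the linear coefficient is not, and which is prime to `q`. -/
theorem exists_shift (hdisc : 4 * A ^ 3 + 27 * B ^ 2 ≠ 0) {q : ℕ} (hq : q.Prime) {n : ℕ}
    (hn : n ≠ 0) : ∃ p : ℕ, p.Prime ∧ ¬ p ∣ n ∧ ∃ r : ℤ, ¬ (q : ℤ) ∣ r ∧
      (p : ℤ) ∣ r ^ 3 + A * r - B ∧ ¬ (p : ℤ) ∣ 3 * r ^ 2 + A := by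
  obtain ⟨p, hp, hpM, r₀, hr₀⟩ := exists_prime_dvd_cubic A B
    (M := (4 * A ^ 3 + 27 * B ^ 2) * (q * n)) (mul_ne_zero hdisc (by
      exact_mod_cast mul_ne_zero hq.ne_zero hn))
  have hpq : IsCoprime (p : ℤ) (q : ℤ) := by
    rw [Nat.isCoprime_iff_coprime, Nat.coprime_primes hp hq]
    rintro rfl
    exact hpM ((dvd_mul_right _ _).mul_left _)
  obtain ⟨a, b, hab⟩ := hpq
  -- The Chinese remainder theorem: `r ≡ r₀` modulo `p` and `r ≡ 1` modulo `q`.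
  let r : ℤ := r₀ + a * p * (1 - r₀)
  have hr : (p : ℤ) ∣ r ^ 3 + A * r - B := by
    have : r ^ 3 + A * r - B = r₀ ^ 3 + A * r₀ - B +
        p * (a * (1 - r₀) * (r ^ 2 + r * r₀ + r₀ ^ 2 + A)) := by simp only [r]; ring
    rw [this]
    exact dvd_add hr₀ (dvd_mul_right _ _)
  refine ⟨p, hp, fun h => hpM ?_, r, fun h => ?_, hr, fun h => hpM ?_⟩
  · exact ((Int.natCast_dvd_natCast.mpr h).mul_left _).mul_left _
  · have h1 : (q : ℤ) ∣ 1 := by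
      have : (1 : ℤ) = r + q * (b * (1 - r₀)) := by
        simp only [r]
        linear_combination (r₀ - 1) * hab
      rw [this]
      exact dvd_add h (dvd_mul_right _ _)
    exact hq.one_lt.ne' (by exact_mod_cast Int.eq_one_of_dvd_one (by positivity) h1)
  · refine Dvd.dvd.mul_right ?_ _
    have : 4 * A ^ 3 + 27 * B ^ 2 = (r ^ 3 + A * r - B) * (-(18 * A * r) - 27 * B) +
        (3 * r ^ 2 + A) * (6 * A * r ^ 2 + 9 * B * r + 4 * A ^ 2) := by ring
    rw [this]
    exact dvd_add (hr.mul_right _) (h.mul_right _)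

end Models

/-! ### Critical points of reductions -/

section Specialization

open Polynomial IsLocalRing

variable (V : ValuationSubring (AlgebraicClosure ℚ))

/-- A version of `exists_root_residue_eq` for polynomials whose leading coefficient is a unit. -/
theorem exists_root_residue_eq_of_isUnit {p : V[X]} {n : ℕ} (hn : p.natDegree ≤ n)
    (hu : residue V (p.coeff n) ≠ 0) {ξ : ResidueField V} (hξ : (p.map (residue V)).eval ξ = 0) :
    ∃ x : V, p.eval x = 0 ∧ residue V x = ξ := by
  obtain ⟨u, hu⟩ := (residue_ne_zero_iff_isUnit _).mp hu
  have hm : (C (↑u⁻¹ : V) * p).Monic := by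
    refine monic_of_natDegree_le_of_coeff_eq_one n ((natDegree_C_mul_le _ _).trans hn) ?_
    rw [coeff_C_mul, ← hu, Units.inv_mul]
  obtain ⟨x, hx, hxξ⟩ := exists_root_residue_eq V hm (ξ := ξ) (by simp [hξ])
  refine ⟨x, ?_, hxξ⟩
  rw [eval_mul, eval_C] at hx
  exact (mul_eq_zero.mp hx).resolve_left (Units.ne_zero _)

variable {V}

theorem residue_intCast_eq_zero_iff {q : ℕ} (hq : q.Prime) (hqV : residue V (q : V) = 0) (z : ℤ) :
    residue V (z : V) = 0 ↔ (q : ℤ) ∣ z := by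
  rw [map_natCast] at hqV
  have : CharP (ResidueField V) q := by
    have h := ringChar.spec (ResidueField V) q |>.mp hqV
    rcases (Nat.dvd_prime hq).mp h with h1 | h1
    · exact absurd h1 CharP.ringChar_ne_one
    · exact ringChar.of_eq h1
  rw [map_intCast, CharP.intCast_eq_zero_iff (ResidueField V) q]

theorem residueField_natCast_ne_zero {q : ℕ} (hq : q.Prime) (hqV : residue V (q : V) = 0) {m : ℕ}
    (hm : ¬ q ∣ m) : (m : ResidueField V) ≠ 0 := by
  intro h
  have := (residue_intCast_eq_zero_iff hq hqV m).mp (by simpa using h)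
  exact hm (Int.natCast_dvd_natCast.mp this)

/-- A polynomial reducing to `X ^ (d - 3) * (X - ρ) ^ 3` has a simple critical point whose critical
value is non-zero and is shared by no other critical point, not even after reduction. -/
theorem exists_critical_point {g : V[X]} {d : ℕ} (hg : g.Monic) (hdeg : g.natDegree = d)
    (hd : 4 ≤ d) {ρ : ResidueField V} (hρ : ρ ≠ 0)
    (hgρ : g.map (residue V) = X ^ (d - 3) * (X - C ρ) ^ 3) (h3 : (3 : ResidueField V) ≠ 0)
    (hd0 : (d : ResidueField V) ≠ 0) (hd3 : ((d - 3 : ℕ) : ResidueField V) ≠ 0) :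
    ∃ (x₀ y₀ : V) (h : (ResidueField V)[X]), g.eval x₀ = y₀ ^ 2 ∧ g.derivative.eval x₀ = 0 ∧
      residue V y₀ ≠ 0 ∧ g.map (residue V) - C (residue V y₀) ^ 2 =
        (X - C (residue V x₀)) ^ 2 * h ∧ h.eval (residue V x₀) ≠ 0 ∧ h.Separable := by
  obtain ⟨m, rfl⟩ : ∃ m, d = m + 4 := ⟨d - 4, by omega⟩
  rw [show m + 4 - 3 = m + 1 by omega] at hgρ hd3
  have hD : (g.map (residue V)).derivative =
      X ^ m * (X - C ρ) ^ 2 * (C ((m + 4 : ℕ) : ResidueField V) * X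
        - C (((m + 1 : ℕ) : ResidueField V) * ρ)) := by
    rw [hgρ]
    simp only [derivative_mul, derivative_pow, derivative_sub, derivative_X,
      derivative_C, C_mul, Nat.cast_add, Nat.cast_one, Nat.cast_ofNat, map_add, map_one,
      Nat.add_sub_cancel, map_natCast, map_ofNat]
    ring
  set ξ : ResidueField V := ((m + 1 : ℕ) : ResidueField V) * ρ / ((m + 4 : ℕ) : ResidueField V)
    with hξ
  have hξd : ((m + 4 : ℕ) : ResidueField V) * ξ = ((m + 1 : ℕ) : ResidueField V) * ρ := by
    rw [hξ]; field_simp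
  have hξ0 : ξ ≠ 0 := div_ne_zero (mul_ne_zero hd3 hρ) hd0
  have hξρ : ξ - ρ ≠ 0 := by
    intro h
    have e : (3 : ResidueField V) * ρ = 0 := by
      rw [sub_eq_zero.mp h] at hξd
      push_cast at hξd
      linear_combination hξd
    exact mul_ne_zero h3 hρ e
  obtain ⟨x₀, hx₀, hxξ⟩ := exists_root_residue_eq_of_isUnit V (p := g.derivative) (n := m + 3)
    (ξ := ξ) ((natDegree_derivative_le g).trans (by omega)) (by
      have : g.coeff (m + 4) = 1 := hdeg ▸ hg.coeff_natDegree
      rw [coeff_derivative, this, one_mul]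
      have e : (((m + 3 : ℕ) : V) + 1) = ((m + 4 : ℕ) : V) := by push_cast; ring
      rw [e, map_natCast]
      exact hd0) (by
      rw [← derivative_map, hD]
      simp only [eval_mul, eval_sub, eval_C, eval_X]
      rw [hξd, sub_self, mul_zero])
  obtain ⟨y₀, hy₀⟩ := exists_pow_eq_valuationSubring V (g.eval x₀) two_ne_zero
  have hy2 : residue V y₀ ^ 2 = ξ ^ (m + 1) * (ξ - ρ) ^ 3 := by
    rw [← map_pow, hy₀, ← eval₂_at_apply, ← eval_map, hgρ, hxξ]
    simp
  have hy0 : residue V y₀ ≠ 0 := by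
    intro h
    rw [h, zero_pow two_ne_zero] at hy2
    exact mul_ne_zero (pow_ne_zero _ hξ0) (pow_ne_zero _ hξρ) hy2.symm
  have hD' : (g.map (residue V) - C (residue V y₀) ^ 2).derivative =
      (g.map (residue V)).derivative := by
    rw [← C_pow, derivative_sub, derivative_C, sub_zero]
  suffices ∃ h : (ResidueField V)[X], g.map (residue V) - C (residue V y₀) ^ 2 =
      (X - C (residue V x₀)) ^ 2 * h ∧ h.eval (residue V x₀) ≠ 0 ∧ h.Separable by
    obtain ⟨h, hh⟩ := this
    exact ⟨x₀, y₀, h, hy₀.symm, hx₀, hy0, hh⟩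
  apply exists_separable_cofactor
  · rw [eval_sub, eval_pow, eval_C, eval_map, eval₂_at_apply, ← hy₀, map_pow, sub_self]
  · rw [hD', derivative_map, eval_map, eval₂_at_apply, hx₀, map_zero]
  · rw [hD', hD, hxξ]
    simp only [derivative_mul, derivative_sub, derivative_X, derivative_C, eval_add, eval_mul,
      eval_sub, eval_C, eval_X, eval_pow, zero_mul, zero_add, mul_one,
      sub_zero, hξd, sub_self, mul_zero]
    exact mul_ne_zero (mul_ne_zero (pow_ne_zero _ hξ0) (pow_ne_zero _ hξρ)) hd0
  · intro z hz hz'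
    have hgz : z ^ (m + 1) * (z - ρ) ^ 3 = residue V y₀ ^ 2 := by
      rw [hgρ] at hz
      simpa [sub_eq_zero] using hz
    have hz0 : z ≠ 0 := by
      rintro rfl
      rw [zero_pow (Nat.succ_ne_zero m), zero_mul] at hgz
      exact pow_ne_zero 2 hy0 hgz.symm
    have hzρ : z - ρ ≠ 0 := by
      intro h
      rw [h] at hgz
      exact pow_ne_zero 2 hy0 (by rw [← hgz]; ring)
    rw [hD', hD] at hz'
    simp only [eval_mul, eval_sub, eval_C, eval_X, eval_pow] at hz'
    have := (mul_eq_zero.mp hz').resolve_left (mul_ne_zero (pow_ne_zero _ hz0) (pow_ne_zero _ hzρ))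
    rw [hxξ, hξ, eq_div_iff hd0]
    linear_combination this

end Specialization

/-! ### The point polynomials -/

section PointPolynomial

open Polynomial IsLocalRing

theorem eval₂_intCastRingHom_shiftedCubic {R : Type*} [CommRing R] (A B r : ℤ) (x : R) :
    (shiftedCubic A B r).eval₂ (Int.castRingHom R) x =
      x ^ 3 + (-3 * r : ℤ) * x ^ 2 + (3 * r ^ 2 + A : ℤ) * x + (-(r ^ 3 + A * r - B) : ℤ) := by
  rw [shiftedCubic_eq]
  simp only [eval₂_add, eval₂_mul, eval₂_C, eval₂_X, eval₂_pow, Int.coe_castRingHom]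

theorem eval₂_pointPolynomial {R : Type*} [CommRing R] (d : ℕ) (F : ℤ[X]) (c : RatFunc ℚ →+* R)
    (x : R) : (pointPolynomial d (F.map (Int.castRingHom ℚ))).eval₂ c x =
      if d = 3 then F.eval₂ (Int.castRingHom R) x - (x + c RatFunc.X) ^ 2
      else if Even d then c RatFunc.X ^ 2 * x ^ d - F.eval₂ (Int.castRingHom R) x
      else x ^ (d - 3) * F.eval₂ (Int.castRingHom R) x - c RatFunc.X ^ 2 := by
  have h : ((F.map (Int.castRingHom ℚ)).map (algebraMap ℚ (RatFunc ℚ))).eval₂ c x =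
      F.eval₂ (Int.castRingHom R) x := by
    rw [eval₂_map, eval₂_map]
    congr 1
    exact Subsingleton.elim _ _
  unfold pointPolynomial
  split_ifs
  · rw [eval₂_sub, h, eval₂_pow, eval₂_add, eval₂_X, eval₂_C]
  · rw [eval₂_sub, h, eval₂_mul, eval₂_C, eval₂_pow, eval₂_X, map_pow]
  · rw [eval₂_sub, eval₂_mul, h, eval₂_C, eval₂_pow, eval₂_X, map_pow]

variable (V : ValuationSubring (AlgebraicClosure ℚ)) {K : Type*} [Field K] [CharZero K]
  [Algebra V[X] K] [IsFractionRing V[X] K]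

omit [CharZero K] in
theorem algebraMap_C_ne_zero {a : V} (ha : a ≠ 0) : algebraMap V[X] K (C a) ≠ 0 :=
  (map_ne_zero_iff _ (IsFractionRing.injective V[X] K)).mpr (C_ne_zero.mpr ha)

omit [CharZero K] in
theorem algebraMap_algebraicClosure_injective :
    Function.Injective (algebraMap V[X] (AlgebraicClosure K)) := by
  rw [IsScalarTower.algebraMap_eq V[X] K (AlgebraicClosure K)]
  exact (algebraMap K _).injective.comp (IsFractionRing.injective V[X] K)

theorem algebraMap_C_intCast {R : Type*} [CommRing R] [Algebra V[X] R] (n : ℤ) :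
    algebraMap V[X] R (C (n : V)) = n :=
  map_intCast ((algebraMap V[X] R).comp C) n

theorem transcendental_algebraMap_C_mul_X {a : V} (ha : a ≠ 0) :
    Transcendental ℚ (algebraMap V[X] K (C a * X)) := by
  intro h
  refine transcendental_algebraMap_X V K ?_
  have h2 := (isAlgebraic_algebraMap_valuationSubring V K a).inv.mul h
  rwa [map_mul, inv_mul_cancel_left₀ (algebraMap_C_ne_zero V ha)] at h2

theorem transcendental_algebraMap_C_add_C_mul_X (b : V) {a : V} (ha : a ≠ 0) :
    Transcendental ℚ (algebraMap V[X] K (C b + C a * X)) := by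
  intro h
  refine transcendental_algebraMap_C_mul_X V (K := K) ha ?_
  have h2 := h.sub (isAlgebraic_algebraMap_valuationSubring V K b)
  rwa [map_add, add_sub_cancel_left] at h2

variable {V}

theorem map_residue_shiftedCubic {q : ℕ} (hq : q.Prime) (hqV : residue V (q : V) = 0) {A B : ℤ}
    (hA : (q : ℤ) ∣ A) (hB : (q : ℤ) ∣ B) (r : ℤ) :
    ((shiftedCubic A B r).map (Int.castRingHom V)).map (residue V) =
      (X - C (residue V (r : V))) ^ 3 := by
  have hA' := (residue_intCast_eq_zero_iff hq hqV A).mpr hA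
  have hB' := (residue_intCast_eq_zero_iff hq hqV B).mpr hB
  simp only [shiftedCubic, Polynomial.map_add, Polynomial.map_sub, Polynomial.map_mul,
    Polynomial.map_pow, map_X, map_C, Int.coe_castRingHom, hA', hB', C_0, zero_mul, add_zero]

theorem valuationSubring_natCast_ne_zero {q : ℕ} (hq : q.Prime) : (q : V) ≠ 0 :=
  Nat.cast_ne_zero.mpr hq.ne_zero

theorem exists_cubeRoot_natCast {p : ℕ} (hp : p.Prime) (hV : residue V (p : V) = 0) :
    ∃ π : V, π ^ 3 = p ∧ π ≠ 0 ∧ residue V π = 0 := by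
  obtain ⟨π, hπ⟩ := exists_pow_eq_valuationSubring V (p : V) three_ne_zero
  refine ⟨π, hπ, ?_, ?_⟩
  · rintro rfl
    rw [zero_pow three_ne_zero] at hπ
    exact valuationSubring_natCast_ne_zero hp hπ.symm
  · rw [← hπ, map_pow] at hV
    exact pow_eq_zero_iff three_ne_zero |>.mp hV

end PointPolynomial

/-! ### Transpositions for the point polynomials -/

section Transpositions

open Polynomial IsLocalRing

variable {V : ValuationSubring (AlgebraicClosure ℚ)}

/-- Over `5`, the equation `x³ + A x + B = (x + t)²` reduces at `t = -2` to
`x³ - (x - 2)² = (x - 1)² (x + 1)`. -/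
theorem hasGalTransposition_pointPolynomial_three (K : Type*) [Field K] [CharZero K]
    [Algebra V[X] K] [IsFractionRing V[X] K] (hV : residue V ((5 : ℕ) : V) = 0) {A B : ℤ}
    (hA : (5 : ℤ) ∣ A) (hB : (5 : ℤ) ∣ B)
    (hP : (pointPolynomial 3 ((shiftedCubic A B 0).map (Int.castRingHom ℚ))).Separable)
    (hdeg : (pointPolynomial 3 ((shiftedCubic A B 0).map (Int.castRingHom ℚ))).natDegree = 3) :
    HasGalTransposition (pointPolynomial 3 ((shiftedCubic A B 0).map (Int.castRingHom ℚ))) := by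
  have hq : Nat.Prime 5 := by norm_num
  have h5 : (5 : ResidueField V) = 0 := by
    rw [map_natCast] at hV
    exact_mod_cast hV
  have h2 : (2 : ResidueField V) ≠ 0 := by
    exact_mod_cast residueField_natCast_ne_zero hq hV (m := 2) (by norm_num)
  have h9 : (9 : ResidueField V) ≠ 0 := by
    exact_mod_cast residueField_natCast_ne_zero hq hV (m := 9) (by norm_num)
  obtain ⟨u, hu⟩ := (residue_ne_zero_iff_isUnit (2 : V)).mp (by rwa [map_ofNat])
  set F : ℤ[X] := shiftedCubic A B 0 with hF
  set g : V[X] := F.map (Int.castRingHom V) with hg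
  have hgm : g.Monic := (shiftedCubic_monic A B 0).map _
  have hgd : g.natDegree = 3 := by
    rw [hg, (shiftedCubic_monic A B 0).natDegree_map, natDegree_shiftedCubic]
  have hgr : g.map (residue V) = X ^ 3 := by
    rw [hg, hF, map_residue_shiftedCubic hq hV (by exact_mod_cast hA) (by exact_mod_cast hB)]
    simp
  -- Points where the graph of `√g` has slope `1`.
  obtain ⟨x₀, hx₀, hxξ⟩ := exists_root_residue_eq_of_isUnit V
    (p := g.derivative ^ 2 - C 4 * g) (n := 4) (ξ := 1) (by
      have hd1 : g.derivative.natDegree ≤ 2 := (natDegree_derivative_le g).trans (by omega)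
      refine (natDegree_sub_le _ _).trans (max_le (natDegree_pow_le.trans (by omega)) ?_)
      exact (natDegree_C_mul_le _ _).trans (by omega)) (by
      have hc : (g.derivative ^ 2 - C 4 * g).coeff 4 = 9 := by
        have hd1 : g.derivative.natDegree ≤ 2 := (natDegree_derivative_le g).trans (by omega)
        have e1 := coeff_pow_of_natDegree_le hd1 (m := 2)
        have e2 : g.coeff 4 = 0 := coeff_eq_zero_of_natDegree_lt (by omega)
        have e3 : g.coeff 3 = 1 := hgd ▸ hgm.coeff_natDegree
        rw [coeff_sub, coeff_C_mul, e2, show 4 = 2 * 2 by norm_num, e1, coeff_derivative, e3]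
        norm_num
      rwa [hc, map_ofNat]) (by
      rw [Polynomial.map_sub, Polynomial.map_pow, ← derivative_map, Polynomial.map_mul, hgr]
      simp only [derivative_X_pow, map_ofNat, eval_sub, eval_pow, eval_mul, eval_C, eval_X]
      norm_num
      exact h5)
  let y₀ : V := ↑u⁻¹ * g.derivative.eval x₀
  have hy₀ : 2 * y₀ = g.derivative.eval x₀ := by
    rw [← hu, Units.mul_inv_cancel_left]
  have hx : g.eval x₀ = y₀ ^ 2 := by
    have e : (4 : V) * g.eval x₀ = 4 * y₀ ^ 2 := by
      have : g.derivative.eval x₀ ^ 2 - 4 * g.eval x₀ = 0 := by simpa using hx₀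
      rw [← hy₀] at this
      linear_combination -this
    have h4 : (4 : V) ≠ 0 := OfNat.ofNat_ne_zero 4
    exact mul_left_cancel₀ h4 e
  have hyr : residue V y₀ = -1 := by
    have e : (2 : ResidueField V) * residue V y₀ = 3 := by
      have h := congrArg (residue V) hy₀
      rw [map_mul, ← eval₂_at_apply, ← eval_map, ← derivative_map, hgr, hxξ] at h
      rw [map_ofNat] at h
      rw [h]
      norm_num
    apply mul_left_cancel₀ h2
    rw [e]
    linear_combination h5
  obtain ⟨ι, hι⟩ := exists_ratFunc_ringHom (transcendental_algebraMap_C_add_C_mul_X V (K := K)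
    (y₀ - 1 * x₀) (pow_ne_zero 2 (valuationSubring_natCast_ne_zero (V := V) hq)))
  refine exists_gal_swap_of_critical_point V h2
    (valuationSubring_natCast_ne_zero hq) hV hP hgm (hgd.trans hdeg.symm) (by omega) (e := 1)
    hx (by rw [← hy₀]; ring) (by rw [hyr]; simp) (h := X + 1) ?_ ?_ ?_ ι id
    Function.injective_id (fun _ _ => rfl) fun x hx => ?_
  · rw [hgr, hxξ, map_sub, hyr, map_mul, hxξ, map_one]
    have h5' : (5 : (ResidueField V)[X]) = 0 := by rw [← map_ofNat C, h5, map_zero]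
    simp only [map_one, map_sub, map_neg, mul_one]
    linear_combination (X - 1) * h5'
  · rw [hxξ]
    simpa only [eval_add, eval_X, eval_one, one_add_one_eq_two] using h2
  · have := separable_X_add_C (1 : ResidueField V)
    rwa [C_1] at this
  · rw [hF, eval₂_pointPolynomial, if_pos rfl, ← hF, sub_eq_zero, RingHom.comp_apply, hι,
      ← IsScalarTower.algebraMap_apply] at hx
    rw [hg, eval₂_map, Subsingleton.elim (RingHom.comp _ (Int.castRingHom V)) (Int.castRingHom _),
      id, hx, map_one, map_one, one_mul x]

/-- Modulo a large prime `q`, the equation `x ^ (d - 3) f(x) = t²` becomes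
`x ^ (d - 3) (x - r) ^ 3 = t²`, whose left hand side has exactly one critical point with non-zero
critical value. -/
theorem hasGalTransposition_pointPolynomial_odd (K : Type*) [Field K] [CharZero K]
    [Algebra V[X] K] [IsFractionRing V[X] K] {d q : ℕ} (hd : 4 ≤ d) (hodd : Odd d) (hq : q.Prime)
    (hdq : d < q) (hV : residue V (q : V) = 0) {A B r : ℤ} (hA : (q : ℤ) ∣ A) (hB : (q : ℤ) ∣ B)
    (hr : ¬ (q : ℤ) ∣ r)
    (hP : (pointPolynomial d ((shiftedCubic A B r).map (Int.castRingHom ℚ))).Separable)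
    (hdeg : (pointPolynomial d ((shiftedCubic A B r).map (Int.castRingHom ℚ))).natDegree = d) :
    HasGalTransposition (pointPolynomial d ((shiftedCubic A B r).map (Int.castRingHom ℚ))) := by
  have hres : ∀ m : ℕ, m ≠ 0 → m < q → (m : ResidueField V) ≠ 0 := fun m h0 hm =>
    residueField_natCast_ne_zero hq hV (Nat.not_dvd_of_pos_of_lt (Nat.pos_of_ne_zero h0) hm)
  have h2 : (2 : ResidueField V) ≠ 0 := by exact_mod_cast hres 2 (by omega) (by omega)
  have h3 : (3 : ResidueField V) ≠ 0 := by exact_mod_cast hres 3 (by omega) (by omega)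
  set F : ℤ[X] := shiftedCubic A B r with hF
  set g : V[X] := X ^ (d - 3) * F.map (Int.castRingHom V) with hg
  have hgm : g.Monic := (monic_X_pow _).mul ((shiftedCubic_monic A B r).map _)
  have hgd : g.natDegree = d := by
    rw [hg, (monic_X_pow _).natDegree_mul ((shiftedCubic_monic A B r).map _), natDegree_X_pow,
      (shiftedCubic_monic A B r).natDegree_map, natDegree_shiftedCubic]
    omega
  obtain ⟨x₀, y₀, h, hx, hx', hy, hh, hh0, hsep⟩ := exists_critical_point hgm hgd hd
    (ρ := residue V (r : V)) (fun h0 => hr ((residue_intCast_eq_zero_iff hq hV r).mp h0)) (by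
      rw [hg, Polynomial.map_mul, map_residue_shiftedCubic hq hV hA hB, Polynomial.map_pow, map_X])
    h3 (hres d (by omega) hdq) (hres (d - 3) (by omega) (by omega))
  obtain ⟨ι, hι⟩ := exists_ratFunc_ringHom (transcendental_algebraMap_C_add_C_mul_X V (K := K)
    y₀ (pow_ne_zero 2 (valuationSubring_natCast_ne_zero (V := V) hq)))
  refine exists_gal_swap_of_critical_point V h2
    (valuationSubring_natCast_ne_zero hq) hV hP hgm (hgd.trans hdeg.symm) (by omega) (e := 0)
    hx (by rw [hx']; ring) hy (h := h) ?_ hh0 hsep ι id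
    Function.injective_id (fun _ _ => rfl) fun x hx => ?_
  · rw [map_zero, C_0, zero_mul, zero_mul, zero_add, sub_zero, hh]
  · rw [hF, eval₂_pointPolynomial, if_neg (by omega), if_neg (Nat.not_even_iff_odd.mpr hodd), ← hF,
      sub_eq_zero, RingHom.comp_apply, hι, ← IsScalarTower.algebraMap_apply] at hx
    rw [hg, eval₂_mul, eval₂_pow, eval₂_X, eval₂_map,
      Subsingleton.elim (RingHom.comp _ (Int.castRingHom V)) (Int.castRingHom _), id, hx, C_0,
      map_zero, zero_mul, zero_mul, zero_add, sub_zero]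

/-- In the variable `1 / x`, the equation `t² x ^ d = f(x)` takes the shape of the one in
`hasGalTransposition_pointPolynomial_odd`, with the reversed polynomial of `f` in place of `f`. -/
theorem hasGalTransposition_pointPolynomial_even (K : Type*) [Field K] [CharZero K]
    [Algebra V[X] K] [IsFractionRing V[X] K] {d q : ℕ} (hd : 4 ≤ d) (heven : Even d) (hq : q.Prime)
    (hdq : d < q) (hV : residue V (q : V) = 0) {A B r : ℤ} (hA : (q : ℤ) ∣ A) (hB : (q : ℤ) ∣ B)
    (hr : ¬ (q : ℤ) ∣ r)
    (hP : (pointPolynomial d ((shiftedCubic A B r).map (Int.castRingHom ℚ))).Separable)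
    (hdeg : (pointPolynomial d ((shiftedCubic A B r).map (Int.castRingHom ℚ))).natDegree = d) :
    HasGalTransposition (pointPolynomial d ((shiftedCubic A B r).map (Int.castRingHom ℚ))) := by
  have hres : ∀ m : ℕ, m ≠ 0 → m < q → (m : ResidueField V) ≠ 0 := fun m h0 hm =>
    residueField_natCast_ne_zero hq hV (Nat.not_dvd_of_pos_of_lt (Nat.pos_of_ne_zero h0) hm)
  have h2 : (2 : ResidueField V) ≠ 0 := by exact_mod_cast hres 2 (by omega) (by omega)
  have h3 : (3 : ResidueField V) ≠ 0 := by exact_mod_cast hres 3 (by omega) (by omega)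
  have hr0 : residue V (r : V) ≠ 0 := fun h0 => hr ((residue_intCast_eq_zero_iff hq hV r).mp h0)
  have hA' := (residue_intCast_eq_zero_iff hq hV A).mpr hA
  have hB' := (residue_intCast_eq_zero_iff hq hV B).mpr hB
  set F₀ : ℤ := -(r ^ 3 + A * r - B) with hF₀
  set F₁ : ℤ := 3 * r ^ 2 + A with hF₁
  set F₂ : ℤ := -3 * r with hF₂
  have hF₀r : residue V (F₀ : V) = -residue V (r : V) ^ 3 := by
    simp only [hF₀, Int.cast_neg, Int.cast_sub, Int.cast_add, Int.cast_mul, Int.cast_pow, map_neg,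
      map_sub, map_add, map_mul, map_pow, hA', hB']
    ring
  have hF₁r : residue V (F₁ : V) = 3 * residue V (r : V) ^ 2 := by
    simp only [hF₁, Int.cast_add, Int.cast_mul, Int.cast_pow, Int.cast_ofNat,
      map_add, map_mul, map_pow, map_ofNat, hA', add_zero]
  have hF₂r : residue V (F₂ : V) = -3 * residue V (r : V) := by
    simp only [hF₂, Int.cast_neg, Int.cast_mul, Int.cast_ofNat, map_neg, map_mul, map_ofNat]
  obtain ⟨u, hu⟩ := (residue_ne_zero_iff_isUnit (F₀ : V)).mp (by
    rw [hF₀r]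
    exact neg_ne_zero.mpr (pow_ne_zero _ hr0))
  set w : V := ↑u⁻¹ with hw
  have hwF : w * (F₀ : V) = 1 := by rw [← hu, hw, Units.inv_mul]
  have hwr : residue V w = -(residue V (r : V))⁻¹ ^ 3 := by
    have := congrArg (residue V) hwF
    rw [map_mul, hF₀r, map_one] at this
    field_simp
    linear_combination -this
  set c : V[X] := X ^ 3 + C (w * F₁) * X ^ 2 + C (w * F₂) * X + C w with hc
  have hcm : c.Monic := by
    rw [hc]
    monicity!
  have hcd : c.natDegree = 3 := by
    rw [hc]
    compute_degree!
  set g : V[X] := X ^ (d - 3) * c with hg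
  have hgm : g.Monic := (monic_X_pow _).mul hcm
  have hgd : g.natDegree = d := by
    rw [hg, (monic_X_pow _).natDegree_mul hcm, natDegree_X_pow, hcd]
    omega
  obtain ⟨x₀, y₀, h, hx, hx', hy, hh, hh0, hsep⟩ := exists_critical_point hgm hgd hd
    (ρ := (residue V (r : V))⁻¹) (inv_ne_zero hr0) (by
      have e1 : residue V w * residue V (F₁ : V) = -3 * (residue V (r : V))⁻¹ := by
        rw [hwr, hF₁r]
        field_simp
      have e2 : residue V w * residue V (F₂ : V) = 3 * (residue V (r : V))⁻¹ ^ 2 := by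
        rw [hwr, hF₂r]
        field_simp
      rw [hg, hc, Polynomial.map_mul, Polynomial.map_pow, map_X]
      congr 1
      simp only [Polynomial.map_add, Polynomial.map_mul, Polynomial.map_pow, map_X, map_C, map_mul]
      rw [← C_mul, ← C_mul, e1, e2, hwr]
      simp only [map_mul, map_neg, map_pow, map_ofNat]
      ring)
    h3 (hres d (by omega) hdq) (hres (d - 3) (by omega) (by omega))
  obtain ⟨b, hb⟩ := exists_pow_eq_valuationSubring V (F₀ : V) two_ne_zero
  have hb0 : b ≠ 0 := by
    rintro rfl
    rw [← hb, zero_pow two_ne_zero, mul_zero] at hwF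
    exact zero_ne_one hwF
  obtain ⟨ι, hι⟩ := exists_ratFunc_ringHom (transcendental_algebraMap_C_add_C_mul_X V (K := K)
    (b * y₀) (mul_ne_zero hb0 (pow_ne_zero 2 (valuationSubring_natCast_ne_zero (V := V) hq))))
  refine exists_gal_swap_of_critical_point V h2
    (valuationSubring_natCast_ne_zero hq) hV hP hgm (hgd.trans hdeg.symm) (by omega) (e := 0)
    hx (by rw [hx']; ring) hy (h := h) ?_ hh0 hsep ι (fun x => x⁻¹)
    inv_injective (fun σ x => (map_inv₀ σ x).symm) fun x hx => ?_
  · rw [map_zero, C_0, zero_mul, zero_mul, zero_add, sub_zero, hh]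
  · let κ : V[X] →+* AlgebraicClosure K := algebraMap V[X] (AlgebraicClosure K)
    rw [eval₂_pointPolynomial, if_neg (by omega), if_pos heven, sub_eq_zero, RingHom.comp_apply, hι,
      ← IsScalarTower.algebraMap_apply, eval₂_intCastRingHom_shiftedCubic, ← hF₀, ← hF₁, ← hF₂]
      at hx
    have hwF' : κ (C w) * (F₀ : AlgebraicClosure K) = 1 := by
      have := congrArg (fun z => κ (C z)) hwF
      simpa using this
    have hbF' : κ (C b) ^ 2 = (F₀ : AlgebraicClosure K) := by
      have := congrArg (fun z => κ (C z)) hb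
      simpa using this
    have hx0 : x ≠ 0 := by
      rintro rfl
      rw [zero_pow (by omega : d ≠ 0), mul_zero] at hx
      rw [show (F₀ : AlgebraicClosure K) = 0 by linear_combination -hx, mul_zero] at hwF'
      exact zero_ne_one hwF'
    set τ := κ (C y₀ + C ((q : V) ^ 2) * X) with hτ
    have hτ' : κ (C (b * y₀) + C (b * (q : V) ^ 2) * X) = κ (C b) * τ := by
      rw [hτ, ← map_mul]
      congr 1
      simp only [C_mul]
      ring
    change κ _ ^ 2 * _ = _ at hx
    rw [hτ'] at hx
    rw [zero_mul, sub_zero, C_0, map_zero, zero_mul, zero_add]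
    change g.eval₂ (κ.comp C) x⁻¹ = τ ^ 2
    have ei : ∀ n : ℤ, κ (C (n : V)) = (n : AlgebraicClosure K) := algebraMap_C_intCast V
    simp only [hg, hc, eval₂_mul, eval₂_pow, eval₂_X, eval₂_add, eval₂_C, RingHom.comp_apply,
      map_mul, ei]
    obtain ⟨m, rfl⟩ : ∃ m, d = m + 3 := ⟨d - 3, by omega⟩
    rw [Nat.add_sub_cancel]
    have hxd : x ^ (m + 3) ≠ 0 := pow_ne_zero _ hx0
    have e : τ ^ 2 * x ^ (m + 3) = κ (C w) * (x ^ 3 + F₂ * x ^ 2 + F₁ * x + F₀) := by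
      rw [← hx, mul_pow, hbF']
      linear_combination -(τ ^ 2 * x ^ (m + 3)) * hwF'
    apply mul_right_cancel₀ hxd
    rw [e, pow_add, inv_pow]
    field_simp
    linear_combination -hwF'

end Transpositions

/-! ### Transitivity for the point polynomials -/

section Transitivity

open Polynomial IsLocalRing

variable {V : ValuationSubring (AlgebraicClosure ℚ)}

/-- If `p` divides `f(0)` but not `f'(0)`, the equation `x ^ d = s² f(x)` becomes
`z ^ d = f'(0) s² z` modulo `p`, after scaling `x` and `s` by powers of the cube root of `p`. -/
theorem hasTransitiveGalOff_pointPolynomial_even (K : Type*) [Field K] [CharZero K]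
    [Algebra V[X] K] [IsFractionRing V[X] K] {d p : ℕ} (hd : 4 ≤ d) (heven : Even d) (hp : p.Prime)
    (hpd : ¬ p ∣ d - 1) (hV : residue V (p : V) = 0) {A B r : ℤ}
    (h0 : (p : ℤ) ∣ r ^ 3 + A * r - B) (h1 : ¬ (p : ℤ) ∣ 3 * r ^ 2 + A)
    (hP : (pointPolynomial d ((shiftedCubic A B r).map (Int.castRingHom ℚ))).Separable)
    (hdeg : (pointPolynomial d ((shiftedCubic A B r).map (Int.castRingHom ℚ))).natDegree = d) :
    HasTransitiveGalOff (pointPolynomial d ((shiftedCubic A B r).map (Int.castRingHom ℚ))) 1 := by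
  obtain ⟨N, hN⟩ := h0
  obtain ⟨π, hπ, hπ0, hπr⟩ := exists_cubeRoot_natCast hp hV
  let m : V[X] := C (π ^ 4) * X ^ 3 + C ((-3 * r : ℤ) * π ^ 2) * X ^ 2 +
    C ((3 * r ^ 2 + A : ℤ) : V) * X + C (π * (-N : ℤ))
  have htr : Transcendental ℚ (algebraMap V[X] K (C (π ^ (d - 1)) * X))⁻¹ := fun h =>
    transcendental_algebraMap_C_mul_X V (K := K) (pow_ne_zero (d - 1) hπ0) (by simpa using h.inv)
  obtain ⟨ι, hι⟩ := exists_ratFunc_ringHom htr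
  have hπK : algebraMap V[X] K (C π) ≠ 0 := algebraMap_C_ne_zero V hπ0
  refine exists_gal_transitive_of_reduction V hP (j := 1) (n := d - 1) (by omega)
    (Nat.Even.sub_odd (by omega) heven odd_one) (residueField_natCast_ne_zero hp hV hpd) (m := m)
    ?_ (b := residue V ((3 * r ^ 2 + A : ℤ) : V))
    (fun h => h1 ((residue_intCast_eq_zero_iff hp hV _).mp h)) ?_ ι
    (fun x => x * algebraMap K _ (algebraMap V[X] K (C π))⁻¹ ^ 2)
    (mul_left_injective₀ (pow_ne_zero 2 ((map_ne_zero_iff _ (algebraMap K _).injective).mpr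
      (inv_ne_zero hπK)))) (fun σ x => by rw [map_mul, map_pow, σ.commutes]) fun x hx => ?_
  · refine lt_of_le_of_lt (b := 3) ?_ (by omega)
    simp only [m]
    compute_degree
  · simp only [m, Polynomial.map_add, Polynomial.map_mul, Polynomial.map_pow, map_X, map_C, map_mul,
      map_pow, hπr]
    simp
  · let κ : V[X] →+* AlgebraicClosure K := algebraMap V[X] (AlgebraicClosure K)
    have ei : ∀ n : ℤ, κ (C (n : V)) = (n : AlgebraicClosure K) := algebraMap_C_intCast V
    have hκ : Function.Injective κ := algebraMap_algebraicClosure_injective V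
    have hs : κ X ≠ 0 := (map_ne_zero_iff κ hκ).mpr X_ne_zero
    have hπκ : κ (C π) ≠ 0 := (map_ne_zero_iff κ hκ).mpr (C_ne_zero.mpr hπ0)
    have hF : (-(r ^ 3 + A * r - B) : ℤ) = κ (C π) ^ 3 * (-N : ℤ) := by
      rw [hN, ← map_pow, ← C_pow, hπ, map_natCast C, map_natCast κ]
      push_cast
      ring
    rw [eval₂_pointPolynomial, if_neg (by omega), if_pos heven, sub_eq_zero, RingHom.comp_apply, hι,
      eval₂_intCastRingHom_shiftedCubic, map_inv₀, ← IsScalarTower.algebraMap_apply, hF] at hx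
    change (κ _)⁻¹ ^ 2 * _ = _ at hx
    rw [map_inv₀, ← IsScalarTower.algebraMap_apply]
    change (x * (κ (C π))⁻¹ ^ 2) ^ (1 + (d - 1)) =
      κ X ^ 2 * m.eval₂ (κ.comp C) (x * (κ (C π))⁻¹ ^ 2)
    obtain ⟨z, rfl⟩ : ∃ z, x = κ (C π) ^ 2 * z := ⟨(κ (C π))⁻¹ ^ 2 * x, by field_simp⟩
    have ez : κ (C π) ^ 2 * z * (κ (C π))⁻¹ ^ 2 = z := by field_simp
    rw [ez]
    simp only [m, eval₂_mul, eval₂_pow, eval₂_X, eval₂_add, eval₂_C, RingHom.comp_apply, map_mul,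
      map_pow, ei] at hx ⊢
    obtain ⟨e, rfl⟩ : ∃ e, d = e + 1 := ⟨d - 1, by omega⟩
    rw [Nat.add_sub_cancel] at hx ⊢
    have hc : κ (C π) ^ 2 ≠ 0 := pow_ne_zero _ hπκ
    rw [add_comm 1 e]
    apply mul_left_cancel₀ hc
    field_simp at hx
    have hc' : (κ (C π) ^ e) ^ 2 ≠ 0 := pow_ne_zero _ (pow_ne_zero _ hπκ)
    apply mul_left_cancel₀ hc'
    linear_combination hx

/-- Under the assumptions of `hasTransitiveGalOff_pointPolynomial_even`, in the variable `1 / x` the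
equation `x ^ (d - 3) f(x) = t²` becomes `w ^ d = f'(0) s² w²` modulo `p`, again after scaling by
powers of the cube root of `p`. -/
theorem hasTransitiveGalOff_pointPolynomial_odd (K : Type*) [Field K] [CharZero K]
    [Algebra V[X] K] [IsFractionRing V[X] K] {d p : ℕ} (hd : 4 ≤ d) (hodd : Odd d) (hp : p.Prime)
    (hpd : ¬ p ∣ d - 2) (hV : residue V (p : V) = 0) {A B r : ℤ}
    (h0 : (p : ℤ) ∣ r ^ 3 + A * r - B) (h1 : ¬ (p : ℤ) ∣ 3 * r ^ 2 + A)
    (hP : (pointPolynomial d ((shiftedCubic A B r).map (Int.castRingHom ℚ))).Separable)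
    (hdeg : (pointPolynomial d ((shiftedCubic A B r).map (Int.castRingHom ℚ))).natDegree = d) :
    HasTransitiveGalOff (pointPolynomial d ((shiftedCubic A B r).map (Int.castRingHom ℚ))) 2 := by
  obtain ⟨N, hN⟩ := h0
  obtain ⟨π, hπ, hπ0, hπr⟩ := exists_cubeRoot_natCast hp hV
  let m : V[X] := C (π * (-N : ℤ)) * X ^ 3 + C ((3 * r ^ 2 + A : ℤ) : V) * X ^ 2 +
    C ((-3 * r : ℤ) * π ^ 2) * X + C (π ^ 4)
  have hπK : algebraMap V[X] K (C (π ^ (d - 2))) ≠ 0 :=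
    algebraMap_C_ne_zero V (pow_ne_zero _ hπ0)
  have htr : Transcendental ℚ (algebraMap V[X] K (C (π ^ (d - 2))) * (algebraMap V[X] K X)⁻¹) := by
    intro h
    have h2 := ((isAlgebraic_algebraMap_valuationSubring V K (π ^ (d - 2))).inv.mul h).inv
    rw [inv_mul_cancel_left₀ hπK, inv_inv] at h2
    exact transcendental_algebraMap_X V K h2
  obtain ⟨ι, hι⟩ := exists_ratFunc_ringHom htr
  have hπK' : algebraMap V[X] K (C π) ≠ 0 := algebraMap_C_ne_zero V hπ0
  refine exists_gal_transitive_of_reduction V hP (j := 2) (n := d - 2) (by omega)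
    (Nat.Odd.sub_even (by omega) hodd even_two) (residueField_natCast_ne_zero hp hV hpd) (m := m)
    ?_ (b := residue V ((3 * r ^ 2 + A : ℤ) : V))
    (fun h => h1 ((residue_intCast_eq_zero_iff hp hV _).mp h)) ?_ ι
    (fun x => x⁻¹ * algebraMap K _ (algebraMap V[X] K (C π)) ^ 2)
    ((mul_left_injective₀ (pow_ne_zero 2 ((map_ne_zero_iff _ (algebraMap K _).injective).mpr
      hπK'))).comp inv_injective) (fun σ x => by rw [map_mul, map_pow, σ.commutes, map_inv₀])
    fun x hx => ?_
  · refine lt_of_le_of_lt (b := 3) ?_ (by omega)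
    simp only [m]
    compute_degree
  · simp only [m, Polynomial.map_add, Polynomial.map_mul, Polynomial.map_pow, map_X, map_C, map_mul,
      map_pow, hπr]
    simp
  · let κ : V[X] →+* AlgebraicClosure K := algebraMap V[X] (AlgebraicClosure K)
    have ei : ∀ n : ℤ, κ (C (n : V)) = (n : AlgebraicClosure K) := algebraMap_C_intCast V
    have hκ : Function.Injective κ := algebraMap_algebraicClosure_injective V
    have hs : κ X ≠ 0 := (map_ne_zero_iff κ hκ).mpr X_ne_zero
    have hπκ : κ (C π) ≠ 0 := (map_ne_zero_iff κ hκ).mpr (C_ne_zero.mpr hπ0)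
    have hF : (-(r ^ 3 + A * r - B) : ℤ) = κ (C π) ^ 3 * (-N : ℤ) := by
      rw [hN, ← map_pow, ← C_pow, hπ, map_natCast C, map_natCast κ]
      push_cast
      ring
    rw [eval₂_pointPolynomial, if_neg (by rintro rfl; omega),
      if_neg (Nat.not_even_iff_odd.mpr hodd), sub_eq_zero, RingHom.comp_apply, hι,
      eval₂_intCastRingHom_shiftedCubic, map_mul, map_inv₀, ← IsScalarTower.algebraMap_apply,
      ← IsScalarTower.algebraMap_apply, hF] at hx
    change _ = (κ _ * (κ X)⁻¹) ^ 2 at hx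
    rw [← IsScalarTower.algebraMap_apply]
    change (x⁻¹ * κ (C π) ^ 2) ^ (2 + (d - 2)) =
      κ X ^ 2 * m.eval₂ (κ.comp C) (x⁻¹ * κ (C π) ^ 2)
    simp only [m, eval₂_mul, eval₂_pow, eval₂_X, eval₂_add, eval₂_C, RingHom.comp_apply, map_mul,
      map_pow, ei] at hx ⊢
    obtain ⟨e, rfl⟩ : ∃ e, d = e + 4 := ⟨d - 4, by omega⟩
    rw [show e + 4 - 3 = e + 1 by omega, show e + 4 - 2 = e + 2 by omega] at hx
    rw [show 2 + (e + 4 - 2) = e + 4 by omega]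
    have hx0 : x ≠ 0 := by
      rintro rfl
      rw [zero_pow (Nat.succ_ne_zero e), zero_mul] at hx
      exact pow_ne_zero 2 (mul_ne_zero (pow_ne_zero _ hπκ) (inv_ne_zero hs)) hx.symm
    have hx' : x ^ (e + 1) * (x ^ 3 + (-3 * r : ℤ) * x ^ 2 + (3 * r ^ 2 + A : ℤ) * x +
        κ (C π) ^ 3 * (-N : ℤ)) * κ X ^ 2 = (κ (C π) ^ (e + 2)) ^ 2 := by
      rw [hx]
      field_simp
    have hxy : x⁻¹ * x = 1 := inv_mul_cancel₀ hx0
    generalize x⁻¹ = y at hxy ⊢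
    have hxy1 : y ^ (e + 1) * x ^ (e + 1) = 1 := by rw [← mul_pow, hxy, one_pow]
    calc (y * κ (C π) ^ 2) ^ (e + 4)
        = y ^ (e + 1) * y ^ 3 * κ (C π) ^ 4 * (κ (C π) ^ (e + 2)) ^ 2 := by ring
      _ = (y ^ (e + 1) * x ^ (e + 1)) * κ X ^ 2 * κ (C π) ^ 4 * ((y * x) ^ 3 +
          (-3 * r : ℤ) * y * (y * x) ^ 2 + (3 * r ^ 2 + A : ℤ) * y ^ 2 * (y * x) +
          κ (C π) ^ 3 * (-N : ℤ) * y ^ 3) := by rw [← hx']; ring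
      _ = _ := by rw [hxy1, hxy]; ring

end Transitivity

/-! ### The symmetric group -/

open Polynomial in
/-- The Galois group of the polynomial attached to a suitable shift of a cubic contains a
transposition: work over a valuation ring above `q`. -/
theorem hasGalTransposition_pointPolynomial {d q : ℕ} (hd : 4 ≤ d) (hq : q.Prime) (hdq : d < q)
    {A B r : ℤ} (hA : (q : ℤ) ∣ A) (hB : (q : ℤ) ∣ B) (hr : ¬ (q : ℤ) ∣ r)
    (hP : (pointPolynomial d ((shiftedCubic A B r).map (Int.castRingHom ℚ))).Separable)
    (hdeg : (pointPolynomial d ((shiftedCubic A B r).map (Int.castRingHom ℚ))).natDegree = d) :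
    HasGalTransposition (pointPolynomial d ((shiftedCubic A B r).map (Int.castRingHom ℚ))) := by
  obtain ⟨V, hV⟩ := exists_valuationSubring_residue_eq_zero hq
  have : CharZero (FractionRing V[X]) :=
    charZero_of_injective_algebraMap (IsFractionRing.injective V[X] _)
  rcases Nat.even_or_odd d with heven | hodd
  · exact hasGalTransposition_pointPolynomial_even (FractionRing V[X]) hd heven hq hdq hV hA hB hr hP
      hdeg
  · exact hasGalTransposition_pointPolynomial_odd (FractionRing V[X]) hd hodd hq hdq hV hA hB hr hP hdeg

open Polynomial in
theorem isPreprimitive_gal_pointPolynomial {d p : ℕ} (hd : 4 ≤ d) (hp : p.Prime)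
    (hpd : ¬ p ∣ (d - 1) * (d - 2)) {A B r : ℤ}
    (h0 : (p : ℤ) ∣ r ^ 3 + A * r - B) (h1 : ¬ (p : ℤ) ∣ 3 * r ^ 2 + A) {P : (RatFunc ℚ)[X]}
    (hPd : P = pointPolynomial d ((shiftedCubic A B r).map (Int.castRingHom ℚ)))
    (hP : P.Separable) (hdeg : P.natDegree = d)
    [MulAction.IsPretransitive P.Gal (P.rootSet P.SplittingField)]
    (hcard : Nat.card (P.rootSet P.SplittingField) = d) :
    MulAction.IsPreprimitive P.Gal (P.rootSet P.SplittingField) := by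
  obtain ⟨V, hV⟩ := exists_valuationSubring_residue_eq_zero hp
  have : CharZero (FractionRing V[X]) :=
    charZero_of_injective_algebraMap (IsFractionRing.injective V[X] _)
  subst hPd
  rcases Nat.even_or_odd d with heven | hodd
  · obtain ⟨S, hS, htr⟩ := hasTransitiveGalOff_pointPolynomial_even (FractionRing V[X]) hd heven hp
      (fun h => hpd (h.mul_right _)) hV h0 h1 hP hdeg
    exact isPreprimitive_of_transitive_off_small_set S (Or.inl hS) htr
  · obtain ⟨S, hS, htr⟩ := hasTransitiveGalOff_pointPolynomial_odd (FractionRing V[X]) hd hodd hp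
      (fun h => hpd (h.mul_left _)) hV h0 h1 hP hdeg
    exact isPreprimitive_of_transitive_off_small_set S (Or.inr ⟨hS, by rwa [hcard]⟩) htr

theorem isIntegralAwayFrom_map_intCast (p : ℕ) (F : ℤ[X]) :
    IsIntegralAwayFrom p (F.map (Int.castRingHom ℚ)) := fun i =>
  ⟨0, F.coeff i, by simp⟩

open Polynomial in
theorem generatesSymmetricExtension_pointPolynomial_three {A B : ℤ} (hA : (5 : ℤ) ∣ A)
    (hB : (5 : ℤ) ∣ B) : GeneratesSymmetricExtension
      (pointPolynomial 3 ((shiftedCubic A B 0).map (Int.castRingHom ℚ))) 3 := by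
  set f := (shiftedCubic A B 0).map (Int.castRingHom ℚ) with hf
  have hfm : f.Monic := (shiftedCubic_monic A B 0).map _
  have hf3 : f.natDegree = 3 := by
    rw [hf, (shiftedCubic_monic A B 0).natDegree_map, natDegree_shiftedCubic]
  have hirr := irreducible_pointPolynomial hfm hf3 le_rfl (fun h => absurd rfl h)
  have hdeg := natDegree_pointPolynomial hfm hf3 le_rfl
  obtain ⟨V, hV⟩ := exists_valuationSubring_residue_eq_zero (q := 5) (by norm_num)
  have : CharZero (FractionRing V[X]) :=
    charZero_of_injective_algebraMap (IsFractionRing.injective V[X] _)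
  refine generatesSymmetricExtension_of_swap hirr hdeg
    (hasGalTransposition_pointPolynomial_three (FractionRing V[X]) hV hA hB hirr.separable hdeg)
    fun _ hcard => MulAction.IsPreprimitive.of_prime_card ?_
  rw [hcard]
  exact Nat.prime_three

open Polynomial in
theorem generatesSymmetricExtension_pointPolynomial_of_four_le {d p q : ℕ} (hd : 4 ≤ d)
    (hq : q.Prime) (hdq : d < q) {A B r : ℤ} (hA : (q : ℤ) ∣ A) (hB : (q : ℤ) ∣ B)
    (hr : ¬ (q : ℤ) ∣ r) (hp : p.Prime) (hpd : ¬ p ∣ (d - 1) * (d - 2))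
    (h0 : (p : ℤ) ∣ r ^ 3 + A * r - B) (h1 : ¬ (p : ℤ) ∣ 3 * r ^ 2 + A) :
    GeneratesSymmetricExtension
      (pointPolynomial d ((shiftedCubic A B r).map (Int.castRingHom ℚ))) d := by
  set f := (shiftedCubic A B r).map (Int.castRingHom ℚ) with hf
  have hfm : f.Monic := (shiftedCubic_monic A B r).map _
  have hf3 : f.natDegree = 3 := by
    rw [hf, (shiftedCubic_monic A B r).natDegree_map, natDegree_shiftedCubic]
  have hirr := irreducible_pointPolynomial hfm hf3 (by omega : 3 ≤ d) (fun _ h => hr (by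
    rw [← coeff_zero_eq_eval_zero, hf, coeff_map, shiftedCubic_coeff_zero, eq_intCast,
      Int.cast_eq_zero] at h
    have h3 : r ^ 3 = B - A * r := by linear_combination -h
    exact (Nat.prime_iff_prime_int.mp hq).dvd_of_dvd_pow
      (h3 ▸ dvd_sub hB (hA.mul_right r))))
  have hdeg := natDegree_pointPolynomial hfm hf3 (by omega : 3 ≤ d)
  exact generatesSymmetricExtension_of_swap hirr hdeg
    (hasGalTransposition_pointPolynomial hd hq hdq hA hB hr hirr.separable hdeg)
    fun _ hcard => isPreprimitive_gal_pointPolynomial hd hp hpd h0 h1 rfl hirr.separable hdeg hcard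

theorem mainTheorem8 (E : WeierstrassCurve ℚ) [E.IsElliptic] (d : ℕ) (hd : 3 ≤ d) :
    ∃ f : ℚ[X], IsWeierstrassModel E f ∧
      (∃ p : ℕ, p.Prime ∧ IsIntegralAwayFrom p f) ∧
      GeneratesSymmetricExtension (pointPolynomial d f) d := by
  rcases hd.eq_or_lt with rfl | hd4
  · obtain ⟨A, B, hA, hB, -, hmodel⟩ :=
      exists_isWeierstrassModel_shiftedCubic E (q := 5) (by norm_num)
    exact ⟨_, hmodel 0, ⟨2, Nat.prime_two, isIntegralAwayFrom_map_intCast 2 _⟩,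
      generatesSymmetricExtension_pointPolynomial_three hA hB⟩
  · obtain ⟨q, hdq, hq⟩ := Nat.exists_infinite_primes (d + 1)
    obtain ⟨A, B, hA, hB, hdisc, hmodel⟩ :=
      exists_isWeierstrassModel_shiftedCubic E hq.ne_zero
    obtain ⟨p, hp, hpd, r, hr, h0, h1⟩ := exists_shift hdisc hq (n := (d - 1) * (d - 2))
      (mul_ne_zero (by omega) (by omega))
    exact ⟨_, hmodel r, ⟨2, Nat.prime_two, isIntegralAwayFrom_map_intCast 2 _⟩,
      generatesSymmetricExtension_pointPolynomial_of_four_le hd4 hq hdq hA hB hr hp hpd h0 h1⟩
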